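/- Let $\mathcal B$ be a real topological vector space with continuous dual $\mathcal B^\star$, and let $\mathbf W\subset\mathcal B$ and $\mathcal X\subset\mathcal B^\star$ be convex and centrally symmetric. For $x\in\mathcal B^\star$ let $\|x\|_{\mathcal X}=\inf\{\alpha>0: x\in\alpha\mathcal X\}\in[0,\infty]$ be the Minkowski functional of $\mathcal X$, and let $\|x\|_{\mathcal W^\star}=\sup_{w\in\mathbf W}|\langle x,w\rangle|\in[0,\infty]$. The value of the $n$-round linear game is $$\mathcal V_n(\mathbf W,\mathcal X)=\inf_{\mathcal A}\ \sup_{f_1,\dots,f_n}\Big(\frac1n\sum_{t=1}^n f_t\big(\mathcal A(f_1,\dots,f_{t-1})\big)-\inf_{w\in\mathbf W}\frac1n\sum_{t=1}^n f_t(w)\Big),$$ where the supremum is over cost functions in $\mathcal F=\{w\mapsto\langle x,w\rangle: x\in\mathcal X\}$, and the infimum is over all online algorithms $\mathcal A$, i.e. maps assigning to each finite sequence of elements of $\mathcal F$ a point of $\mathbf W$. Let $\epsilon=(\epsilon_i)_{i\ge1}$ be independent uniformly random signs. A Walsh–Paley martingale is given by a point $x_0\in\mathcal B^\star$ and maps $x_i:\{\pm1\}^{i-1}\to\mathcal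 B^\star$, $i\ge 1$; write $x_i(\epsilon)=x_i(\epsilon_1,\dots,\epsilon_{i-1})$. The pair $(\mathcal W^\star,\mathcal X)$ has martingale type $p$ with constant $C$ if for all such $x_0,(x_i)_{i\ge1}$ $$\sup_n \mathbb E\Big\|x_0+\sum_{i=1}^n\epsilon_i x_i(\epsilon)\Big\|^p_{\mathcal W^\star}\le C^p\Big(\|x_0\|_{\mathcal X}^p+\sum_{i\ge1}\mathbb E\|x_i(\epsilon)\|_{\mathcal X}^p\Big),$$ and it has martingale type $p$ if this holds for some $C\ge1$. Let $r\in(1,2]$ and $D>0$. (a) If $\mathcal V_n(\mathbf W,\mathcal X)\le D\,n^{-(1-1/r)}$ for all $n\ge1$, then for every $0<p<r$ the pair $(\mathcal W^\star,\mathcal X)$ has martingale type $p$ with constant $\dfrac{1104\,D}{(r-p)^2}$; in particular, it has martingale type $p$. (b) The same conclusion holds if, instead of the bound on the value, one assumes that for all $x_0$, all $(x_i)_{i\ge1}$ as above and all $n\ge1$ $$\mathbb E\Big\|x_0+\sum_{i=1}^n\epsilon_i x_i(\epsilon)\Big\|_{\mathcal W^\star}\le D\,(n+1)^{1/r}\ \sup_{0\le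 i\le n}\ \sup_\epsilon\|x_i(\epsilon)\|_{\mathcal X}.$$ -/

import Mathlib

open scoped ENNReal

noncomputable section

namespace OnlineGame

/-! ### The online game -/

section Game

variable {B : Type*}

/-- A (deterministic) online learning algorithm: in each round it maps the cost functions of the
earlier rounds (`t` of them) to a predictor in `W`. -/
def Algorithm (W : Set B) (F : Set (W → ℝ)) : Type _ :=
  (t : ℕ) → (Fin t → F) → W

/-- The normalized regret
`(1/n) ∑ₜ fₜ(A(f₁,…,fₜ₋₁)) - inf_{w ∈ W} (1/n) ∑ₜ fₜ(w)`.
It is extended-real valued since the infimum may be `-∞`. -/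
def regret {W : Set B} {F : Set (W → ℝ)} (A : Algorithm W F) (n : ℕ) (f : Fin n → F) : EReal :=
  (((1 / (n : ℝ)) *
      ∑ t : Fin n, (f t : W → ℝ) (A t (fun j : Fin t => f (Fin.castLE t.isLt.le j))) : ℝ) : EReal)
    - ⨅ w : W, (((1 / (n : ℝ)) * ∑ t : Fin n, (f t : W → ℝ) w : ℝ) : EReal)

/-- The value of the `n`-round game: the best worst-case regret. -/
def value (W : Set B) (F : Set (W → ℝ)) (n : ℕ) : EReal :=
  ⨅ A : Algorithm W F, ⨆ f : Fin n → F, regret A n f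

variable [AddCommGroup B] [Module ℝ B] [TopologicalSpace B]

/-- The linear cost functions `w ↦ ⟨x, w⟩` on `W`, for `x` in the data domain `X`. -/
def linearCosts (W : Set B) (X : Set (StrongDual ℝ B)) : Set (W → ℝ) :=
  {f | ∃ x ∈ X, f = fun w : W => x (w : B)}

/-- The value `𝒱ₙ(W, X)` of the linear game. -/
def linearValue (W : Set B) (X : Set (StrongDual ℝ B)) (n : ℕ) : EReal :=
  value W (linearCosts W X) n

/-- The dual norm `‖x‖_{W*} = sup_{w ∈ W} |⟨x, w⟩|`, with values in `[0, ∞]`. -/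
def dualNorm (W : Set B) (x : StrongDual ℝ B) : ℝ≥0∞ :=
  ⨆ w ∈ W, ‖x w‖ₑ

end Game

/-! ### Walsh–Paley martingales and martingale type -/

/-- The expectation of a function of `n` independent uniformly random signs. -/
def signExpectation (n : ℕ) (g : (Fin n → ℤˣ) → ℝ≥0∞) : ℝ≥0∞ :=
  ((2 : ℝ≥0∞) ^ n)⁻¹ * ∑ ε : Fin n → ℤˣ, g ε

section Martingale

variable {B : Type*} [AddCommGroup B] [Module ℝ B] [TopologicalSpace B]
  [IsTopologicalAddGroup B] [ContinuousSMul ℝ B]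

/-- The increments of a Walsh–Paley martingale: the `(i+1)`-st increment is a function of the
first `i` signs. -/
abbrev Increments (B : Type*) [AddCommGroup B] [Module ℝ B] [TopologicalSpace B] : Type _ :=
  (i : ℕ) → (Fin i → ℤˣ) → StrongDual ℝ B

/-- `x₀ + ∑_{i=1}^n εᵢ xᵢ(ε₁,…,εᵢ₋₁)`; here `x i` is the `(i+1)`-st increment. -/
def walshPaley (x₀ : StrongDual ℝ B) (x : Increments B) (n : ℕ) (ε : Fin n → ℤˣ) :
    StrongDual ℝ B :=
  x₀ + ∑ i : Fin n, (((ε i : ℤ) : ℝ)) • x i (fun j : Fin i => ε (Fin.castLE i.isLt.le j))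

/-- The martingale type inequality for the pair `(W*, X)` with exponent `p` and constant `C`.
For convex centrally symmetric `X`, `egauge ℝ X` is the Minkowski functional of `X`. -/
def MartingaleTypeWith (W : Set B) (X : Set (StrongDual ℝ B)) (p C : ℝ) : Prop :=
  ∀ (x₀ : StrongDual ℝ B) (x : Increments B),
    ⨆ n : ℕ, signExpectation n (fun ε => dualNorm W (walshPaley x₀ x n ε) ^ p) ≤
      ENNReal.ofReal C ^ p *
        (egauge ℝ X x₀ ^ p + ∑' i : ℕ, signExpectation i (fun ε => egauge ℝ X (x i ε) ^ p))

/-- The pair `(W*, X)` has martingale type `p`. -/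
def HasMartingaleType (W : Set B) (X : Set (StrongDual ℝ B)) (p : ℝ) : Prop :=
  ∃ C : ℝ, 1 ≤ C ∧ MartingaleTypeWith W X p C

/-- `sup_{0 ≤ i ≤ n} sup_ε ‖xᵢ(ε)‖_X`. -/
def supIncrement (X : Set (StrongDual ℝ B)) (x₀ : StrongDual ℝ B) (x : Increments B) (n : ℕ) :
    ℝ≥0∞ :=
  egauge ℝ X x₀ ⊔ ⨆ i : Fin n, ⨆ ε : Fin i → ℤˣ, egauge ℝ X (x i ε)

/-- First moments of `n`-step Walsh–Paley martingales are at most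
`D (n+1)^{1/r} sup_{0 ≤ i ≤ n} sup_ε ‖xᵢ(ε)‖_X`, for all `n ≥ 1`. -/
def MartingaleGrowth (W : Set B) (X : Set (StrongDual ℝ B)) (r D : ℝ) : Prop :=
  ∀ (x₀ : StrongDual ℝ B) (x : Increments B) (n : ℕ), 1 ≤ n →
    signExpectation n (fun ε => dualNorm W (walshPaley x₀ x n ε)) ≤
      ENNReal.ofReal (D * ((n : ℝ) + 1) ^ (1 / r)) * supIncrement X x₀ x n

end Martingale

end OnlineGame

end

/-!
A bound on the value of the game, or on the first moments of Walsh–Paley martingales, both lead to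
the same *growth bound*: `n`-step martingales whose increments have `X`-gauge at most `c` have first
`W*`-moment at most `D (n + 1) ^ (1 / r) c` (`growthBound_of_linearValue_le`,
`growthBound_of_martingaleGrowth`). For the game, a nearly optimal algorithm is run against the
random costs `εₜ xₜ(ε)`. Its own expected loss is zero because its prediction does not depend on
`εₜ`, so that its regret is the dual norm of the martingale in expectation.

From the growth bound to type `p` there are two cases. For `p ≤ 1` the function `t ↦ t ^ p` is
subadditive, and it is enough that `‖x‖_{W*} ≤ 2 D ‖x‖_X`, the growth bound for one step. For
`1 < p < r` the argument is Burkholder's.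

* If `∑ ‖xᵢ‖ ^ p ≤ b ^ p` on every path, then the first moment is at most `16 D b / (r - p)`
  (`SignTree.expect_le_of_maxCost_le`). The increments are sorted into dyadic levels by their size.
  A path has at most `2 ^ ((k + 1) p)` increments in level `k`; a martingale with few nonzero
  increments can be shortened accordingly without lowering its moment
  (`SignTree.exists_depth_le_count`), so the growth bound applies to each level. The resulting
  series is geometric with ratio `2 ^ (-(1 - p / r))`.
* The increments are predictable, so a martingale can be stopped before the sum of `‖xᵢ‖ ^ p` gets
  too large. With Markov's inequality this gives the good-`λ` inequality
  `P(f* > 2 λ) ≤ P(f* > λ) / 8 + P(∑ ‖xᵢ‖ ^ p > (δ λ) ^ p)` for the maximum `f*` of the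
  martingale (`SignTree.expect_track_good_lambda`), where `δ = (r - p) / (256 D)`.
* Integrating against `p λ ^ (p - 1)` bounds the `p`-th moment of `f*`, with the constant
  `4 / δ = 1024 D / (r - p)`, which is at most `1104 D / (r - p) ^ 2` as `r - p ≤ 1`.

Martingales of bounded length are represented by binary trees (`SignTree`), on which stopping,
shortening and sorting of increments are structural recursions.
-/

noncomputable section

/-! ### Sign trees -/

/-- A finite binary tree describing a Walsh–Paley martingale of bounded length: the label of a node
is the increment, and the two subtrees describe how the martingale goes on after it has been added
and after it has been subtracted. At a leaf the martingale stops. -/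
inductive SignTree (E : Type*) where
  | leaf : SignTree E
  | node (x : E) (pos neg : SignTree E) : SignTree E

namespace SignTree

variable {E σ : Type*}

/-- The expectation of `φ` at the final state, for a process that is driven by fair signs along a
sign tree: at a node with label `x` the state `a` becomes `step a x` or `step a (-x)`. -/
def expect [Neg E] (step : σ → E → σ) (φ : σ → ℝ≥0∞) : SignTree E → σ → ℝ≥0∞
  | leaf, a => φ a
  | node x l r, a => (expect step φ l (step a x) + expect step φ r (step a (-x))) / 2

/-- The length of the longest branch. -/
def depth : SignTree E → ℕ
  | leaf => 0
  | node _ l r => max l.depth r.depth + 1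

/-- All labels satisfy `P`. -/
def All (P : E → Prop) : SignTree E → Prop
  | leaf => True
  | node x l r => P x ∧ l.All P ∧ r.All P

/-- The largest sum of `w` over the labels of a branch. -/
def maxCost {R : Type*} [Add R] [Zero R] [Max R] (w : E → R) : SignTree E → R
  | leaf => 0
  | node x l r => w x + max (l.maxCost w) (r.maxCost w)

/-- Relabelling. -/
def map (f : E → E) : SignTree E → SignTree E
  | leaf => leaf
  | node x l r => node (f x) (l.map f) (r.map f)

theorem All.mono {P Q : E → Prop} (h : ∀ x, P x → Q x) :
    ∀ {t : SignTree E}, t.All P → t.All Q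
  | leaf, _ => trivial
  | node _ _ _, ⟨h₀, h₁, h₂⟩ => ⟨h _ h₀, h₁.mono h, h₂.mono h⟩

theorem All.map {P Q : E → Prop} {f : E → E} (h : ∀ x, P x → Q (f x)) :
    ∀ {t : SignTree E}, t.All P → (t.map f).All Q
  | leaf, _ => trivial
  | node _ _ _, ⟨h₀, h₁, h₂⟩ => ⟨h _ h₀, h₁.map h, h₂.map h⟩

theorem all_of_forall {P : E → Prop} (h : ∀ x, P x) : ∀ t : SignTree E, t.All P
  | leaf => trivial
  | node _ l r => ⟨h _, all_of_forall h l, all_of_forall h r⟩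

theorem depth_map (f : E → E) : ∀ t : SignTree E, (t.map f).depth = t.depth
  | leaf => rfl
  | node _ l r => by simp [map, depth, depth_map f l, depth_map f r]

theorem map_eq_self {f : E → E} : ∀ {t : SignTree E}, t.All (fun x => f x = x) → t.map f = t
  | leaf, _ => rfl
  | node x l r, ⟨h₀, h₁, h₂⟩ => by rw [map, h₀, map_eq_self h₁, map_eq_self h₂]

theorem all_of_maxCost_le {w : E → ℝ≥0∞} {c : ℝ≥0∞} :
    ∀ {t : SignTree E}, t.maxCost w ≤ c → t.All (w · ≤ c)
  | leaf, _ => trivial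
  | node x l r, h => by
    rw [maxCost] at h
    exact ⟨le_self_add.trans h,
      all_of_maxCost_le (((le_max_left _ _).trans le_add_self).trans h),
      all_of_maxCost_le (((le_max_right _ _).trans le_add_self).trans h)⟩

section Expect

variable [Neg E] {step : σ → E → σ} {φ ψ : σ → ℝ≥0∞}

theorem expect_mono_of_invariant {I : σ → Prop} (hI : ∀ a x, I a → I (step a x))
    (h : ∀ a, I a → φ a ≤ ψ a) :
    ∀ (t : SignTree E) (a : σ), I a → expect step φ t a ≤ expect step ψ t a
  | leaf, a, ha => h a ha
  | node x l r, a, ha => by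
    simp only [expect]
    gcongr
    · exact expect_mono_of_invariant hI h l _ (hI _ _ ha)
    · exact expect_mono_of_invariant hI h r _ (hI _ _ ha)

theorem expect_mono (h : ∀ a, φ a ≤ ψ a) (t : SignTree E) (a : σ) :
    expect step φ t a ≤ expect step ψ t a :=
  expect_mono_of_invariant (I := fun _ => True) (fun _ _ _ => trivial) (fun a _ => h a) t a trivial

theorem expect_const (c : ℝ≥0∞) : ∀ (t : SignTree E) (a : σ), expect step (fun _ => c) t a = c
  | leaf, _ => rfl
  | node x l r, a => by
    simp only [expect, expect_const c l, expect_const c r]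
    rw [ENNReal.add_div, ENNReal.add_halves]

theorem expect_eq_const_of_invariant {I : σ → Prop} (hI : ∀ a x, I a → I (step a x)) (c : ℝ≥0∞)
    (h : ∀ a, I a → φ a = c) (t : SignTree E) (a : σ) (ha : I a) : expect step φ t a = c := by
  refine le_antisymm ?_ ?_
  · exact (expect_mono_of_invariant (ψ := fun _ => c) hI (fun a ha => (h a ha).le) t a ha).trans_eq
      (expect_const c t a)
  · exact (expect_const c t a).symm.trans_le
      (expect_mono_of_invariant (φ := fun _ => c) hI (fun a ha => (h a ha).ge) t a ha)

theorem expect_add : ∀ (t : SignTree E) (a : σ),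
    expect step (fun a => φ a + ψ a) t a = expect step φ t a + expect step ψ t a
  | leaf, _ => rfl
  | node x l r, a => by
    simp only [expect, expect_add l, expect_add r, ENNReal.add_div]
    ring

theorem expect_const_mul (c : ℝ≥0∞) : ∀ (t : SignTree E) (a : σ),
    expect step (fun a => c * φ a) t a = c * expect step φ t a
  | leaf, _ => rfl
  | node x l r, a => by
    simp only [expect, expect_const_mul c l, expect_const_mul c r]
    rw [← mul_add, mul_div_assoc]

open MeasureTheory in
theorem measurable_expect {α : Type*} [MeasurableSpace α] {Φ : α → σ → ℝ≥0∞}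
    (hΦ : ∀ a, Measurable fun u => Φ u a) :
    ∀ (t : SignTree E) (a : σ), Measurable fun u => expect step (Φ u) t a
  | leaf, a => hΦ a
  | node x l r, a => by
    simp only [expect]
    exact ((measurable_expect hΦ l _).add (measurable_expect hΦ r _)).div_const _

open MeasureTheory in
theorem lintegral_expect {α : Type*} [MeasurableSpace α] (μ : Measure α) {Φ : α → σ → ℝ≥0∞}
    (hΦ : ∀ a, Measurable fun u => Φ u a) :
    ∀ (t : SignTree E) (a : σ),
      ∫⁻ u, expect step (Φ u) t a ∂μ = expect step (fun a => ∫⁻ u, Φ u a ∂μ) t a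
  | leaf, a => rfl
  | node x l r, a => by
    simp only [expect, div_eq_mul_inv]
    rw [lintegral_mul_const' _ _ (by simp),
      lintegral_add_left (measurable_expect hΦ l _), lintegral_expect μ hΦ l,
      lintegral_expect μ hΦ r]

end Expect

/-! ### Subadditive functions of the final value -/

section Subadditive

variable [AddCommGroup E] {N : E → ℝ≥0∞}

theorem expect_map_add_le (hadd : ∀ x y, N (x + y) ≤ N x + N y) {f g h : E → E}
    (hf : ∀ x, f x = g x + h x) :
    ∀ (t : SignTree E) (y z : E), expect (· + ·) N (t.map f) (y + z) ≤
      expect (· + ·) N (t.map g) y + expect (· + ·) N (t.map h) z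
  | leaf, y, z => hadd y z
  | node x l r, y, z => by
    simp only [map, expect]
    have h₁ : y + z + f x = (y + g x) + (z + h x) := by rw [hf]; abel
    have h₂ : y + z + -f x = (y + -g x) + (z + -h x) := by rw [hf]; abel
    rw [h₁, h₂, ← ENNReal.add_div]
    refine (ENNReal.div_le_div_right (add_le_add (expect_map_add_le hadd hf l _ _)
      (expect_map_add_le hadd hf r _ _)) 2).trans_eq ?_
    congr 1
    ring

/-- Markov's inequality for the event that `N` exceeds `L` at the end. -/
theorem expect_indicator_le (hadd : ∀ x y, N (x + y) ≤ N x + N y) {y : E} {a L : ℝ≥0∞}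
    (ha : a ≠ 0) (ha' : a ≠ ∞) (hy : N y ≠ ∞) (hL : N y + a ≤ L) :
    ∀ (t : SignTree E) (z : E), expect (· + ·) (fun v => if L < N v then 1 else 0) t (y + z) ≤
      expect (· + ·) N t z / a
  | leaf, z => by
    simp only [expect]
    split_ifs with h
    · rw [ENNReal.le_div_iff_mul_le (.inl ha) (.inl ha'), one_mul]
      exact (ENNReal.add_le_add_iff_left hy).1 (hL.trans (h.le.trans (hadd y z)))
    · exact zero_le
  | node x l r, z => by
    simp only [expect, add_assoc]
    rw [ENNReal.div_right_comm, ENNReal.add_div (c := a)]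
    gcongr
    · exact expect_indicator_le hadd ha ha' hy hL l _
    · exact expect_indicator_le hadd ha ha' hy hL r _

end Subadditive

/-! ### Removing zero labels -/

section Compress

variable [AddCommGroup E]

open Classical in
/-- The largest number of nonzero labels on a branch. -/
def count (t : SignTree E) : ℕ := t.maxCost fun x => if x = 0 then 0 else 1

/-- The length of a martingale can be reduced to the number of its nonzero increments: where the
increment is zero, the better one of the two continuations is used at once. -/
theorem exists_depth_le_count {P : E → Prop} (φ : E → ℝ≥0∞) :
    ∀ (t : SignTree E) (y : E), t.All P → ∃ t' : SignTree E, t'.depth ≤ t.count ∧ t'.All P ∧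
      expect (· + ·) φ t y ≤ expect (· + ·) φ t' y
  | leaf, y, _ => ⟨leaf, le_rfl, trivial, le_rfl⟩
  | node x l r, y, ⟨h₀, h₁, h₂⟩ => by
    obtain ⟨l', hl, hlP, hl'⟩ := exists_depth_le_count φ l (y + x) h₁
    obtain ⟨r', hr, hrP, hr'⟩ := exists_depth_le_count φ r (y + -x) h₂
    by_cases hx : x = 0
    · subst hx
      simp only [neg_zero, add_zero, expect] at hl' hr' ⊢
      have hcount : (node 0 l r).count = max l.count r.count := by simp [count, maxCost]
      rw [hcount]
      rcases le_total (expect (· + ·) φ l' y) (expect (· + ·) φ r' y) with h | h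
      · refine ⟨r', hr.trans (le_max_right _ _), hrP, ?_⟩
        calc _ ≤ (expect (· + ·) φ r' y + expect (· + ·) φ r' y) / 2 := by
              gcongr; exact hl'.trans h
          _ = _ := by rw [ENNReal.add_div, ENNReal.add_halves]
      · refine ⟨l', hl.trans (le_max_left _ _), hlP, ?_⟩
        calc _ ≤ (expect (· + ·) φ l' y + expect (· + ·) φ l' y) / 2 := by
              gcongr; exact hr'.trans h
          _ = _ := by rw [ENNReal.add_div, ENNReal.add_halves]
    · refine ⟨node x l' r', ?_, ⟨h₀, hlP, hrP⟩, ?_⟩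
      · have hcount : (node x l r).count = 1 + max l.count r.count := by
          simp [count, maxCost, hx]
        rw [hcount, depth, add_comm]
        gcongr
      · simp only [expect]
        gcongr

theorem count_map_mul_le {w : E → ℝ≥0∞} {f : E → E} {θ : ℝ≥0∞} (h : ∀ x, f x ≠ 0 → θ ≤ w x) :
    ∀ t : SignTree E, ((t.map f).count : ℝ≥0∞) * θ ≤ t.maxCost w
  | leaf => by simp [count, maxCost, map]
  | node x l r => by
    have hl := count_map_mul_le h l
    have hr := count_map_mul_le h r
    have hmax : ((max (l.map f).count (r.map f).count : ℕ) : ℝ≥0∞) * θ ≤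
        max (l.maxCost w) (r.maxCost w) := by
      rcases le_total (l.map f).count (r.map f).count with h' | h'
      · rw [max_eq_right h']; exact hr.trans (le_max_right _ _)
      · rw [max_eq_left h']; exact hl.trans (le_max_left _ _)
    by_cases hx : f x = 0
    · have hcount : ((node x l r).map f).count = max (l.map f).count (r.map f).count := by
        simp [count, maxCost, map, hx]
      rw [hcount, maxCost]
      exact hmax.trans le_add_self
    · have hcount : ((node x l r).map f).count = 1 + max (l.map f).count (r.map f).count := by
        simp [count, maxCost, map, hx]
      rw [hcount, maxCost, Nat.cast_add, add_mul, Nat.cast_one, one_mul]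
      exact add_le_add (h x hx) hmax

end Compress

end SignTree

/-! ### Martingales with bounded `p`-variation -/

/-- An even subadditive function with values in `[0, ∞]` that vanishes at `0`. -/
structure EvenSubadditive {E : Type*} [AddCommGroup E] (N : E → ℝ≥0∞) : Prop where
  zero : N 0 = 0
  add_le : ∀ x y, N (x + y) ≤ N x + N y
  neg : ∀ x, N (-x) = N x

namespace SignTree

variable {E : Type*} [AddCommGroup E]

/-- The first moments of `n`-step martingales with increments of size at most `c`, as measured by
`G`, are at most `D (n+1)^{1/r} c`. -/
def GrowthBound (N G : E → ℝ≥0∞) (r D : ℝ) : Prop :=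
  ∀ (n : ℕ) (t : SignTree E) (c : ℝ≥0∞), 1 ≤ n → t.depth ≤ n → t.All (G · ≤ c) →
    expect (· + ·) N t 0 ≤ ENNReal.ofReal (D * ((n : ℝ) + 1) ^ (1 / r)) * c

variable {N G : E → ℝ≥0∞} {r D : ℝ}

theorem GrowthBound.apply_le (h : GrowthBound N G r D) (hN : EvenSubadditive N) (hr : 1 < r)
    (hD : 0 < D) (x : E) : N x ≤ ENNReal.ofReal (2 * D) * G x := by
  have h₁ := h 1 (node x leaf leaf) (G x) le_rfl (by simp [depth]) ⟨le_rfl, trivial, trivial⟩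
  simp only [expect, zero_add, hN.neg, ENNReal.add_div, ENNReal.add_halves] at h₁
  refine h₁.trans ?_
  gcongr ENNReal.ofReal ?_ * _
  have : ((1 : ℕ) + 1 : ℝ) ^ (1 / r) ≤ (2 : ℝ) ^ (1 : ℝ) := by
    rw [Nat.cast_one, one_add_one_eq_two]
    exact Real.rpow_le_rpow_of_exponent_le (by norm_num)
      ((div_le_one (by linarith)).2 hr.le)
  rw [Real.rpow_one] at this
  nlinarith

/-- The label, if it lies in the `k`-th dyadic level below `b`, and otherwise zero. -/
def level (G : E → ℝ≥0∞) (b : ℝ) (k : ℕ) (x : E) : E :=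
  open Classical in
  if ENNReal.ofReal (b * 2⁻¹ ^ (k + 1)) < G x ∧ G x ≤ ENNReal.ofReal (b * 2⁻¹ ^ k) then x else 0

/-- The label, if it is in one of the dyadic levels from the `k`-th on, and otherwise zero. -/
def lowLevels (G : E → ℝ≥0∞) (b : ℝ) (k : ℕ) (x : E) : E :=
  open Classical in if G x ≤ ENNReal.ofReal (b * 2⁻¹ ^ k) then x else 0

theorem lowLevels_eq_add {b : ℝ} (hb : 0 < b) (k : ℕ) (x : E) :
    lowLevels G b k x = level G b k x + lowLevels G b (k + 1) x := by
  have hle : ENNReal.ofReal (b * 2⁻¹ ^ (k + 1)) ≤ ENNReal.ofReal (b * 2⁻¹ ^ k) := by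
    refine ENNReal.ofReal_le_ofReal (mul_le_mul_of_nonneg_left ?_ hb.le)
    exact pow_le_pow_of_le_one (by norm_num) (by norm_num) (Nat.le_succ k)
  simp only [lowLevels, level]
  by_cases h₁ : G x ≤ ENNReal.ofReal (b * 2⁻¹ ^ (k + 1))
  · simp [-inv_pow, h₁, h₁.trans hle, h₁.not_gt]
  · by_cases h₂ : G x ≤ ENNReal.ofReal (b * 2⁻¹ ^ k)
    · simp [-inv_pow, h₁, h₂, not_le.1 h₁]
    · simp [-inv_pow, h₁, h₂]

theorem expect_map_lowLevels_le (hN : EvenSubadditive N) {b : ℝ} (hb : 0 < b) (t : SignTree E) :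
    ∀ K : ℕ, expect (· + ·) N (t.map (lowLevels G b 0)) 0 ≤
      ∑ k ∈ Finset.range K, expect (· + ·) N (t.map (level G b k)) 0 +
        expect (· + ·) N (t.map (lowLevels G b K)) 0
  | 0 => by simp
  | K + 1 => by
    refine (expect_map_lowLevels_le hN hb t K).trans ?_
    rw [Finset.sum_range_succ, add_assoc]
    gcongr
    simpa using expect_map_add_le hN.add_le (lowLevels_eq_add hb K) t 0 0

/-- A branch has at most `2 ^ ((k + 1) p)` labels in the `k`-th dyadic level. -/
theorem expect_map_level_le (h : GrowthBound N G r D) (hG : G 0 = 0) (hr : 1 < r) (hD : 0 < D)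
    {p b : ℝ} (hp : 0 < p) (hpr : p < r) (hb : 0 < b) {t : SignTree E}
    (ht : t.maxCost (fun x => G x ^ p) ≤ ENNReal.ofReal b ^ p) (k : ℕ) :
    expect (· + ·) N (t.map (level G b k)) 0 ≤
      ENNReal.ofReal (4 * D * b * ((2 : ℝ)⁻¹ ^ (1 - p / r)) ^ k) := by
  have hbk : 0 < b * 2⁻¹ ^ (k + 1) := by positivity
  have hcount : ((t.map (level G b k)).count : ℝ) ≤ 2 ^ ((k + 1 : ℝ) * p) := by
    have h₁ : ((t.map (level G b k)).count : ℝ≥0∞) * ENNReal.ofReal (b * 2⁻¹ ^ (k + 1)) ^ p ≤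
        ENNReal.ofReal b ^ p := by
      refine (count_map_mul_le (w := fun x => G x ^ p) (fun x hx => ?_) t).trans ht
      refine ENNReal.rpow_le_rpow (le_of_lt ?_) hp.le
      by_contra hlt
      exact hx (by simp [-inv_pow, level, hlt])
    rw [ENNReal.ofReal_rpow_of_pos hbk, ENNReal.ofReal_rpow_of_pos hb, ← ENNReal.ofReal_natCast,
      ← ENNReal.ofReal_mul (by positivity), ENNReal.ofReal_le_ofReal_iff (by positivity),
      Real.mul_rpow hb.le (by positivity)] at h₁
    have h₂ : ((2 : ℝ)⁻¹ ^ (k + 1)) ^ p = ((2 : ℝ) ^ ((k + 1 : ℝ) * p))⁻¹ := by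
      rw [inv_pow, Real.inv_rpow (by positivity), ← Real.rpow_natCast, ← Real.rpow_mul (by norm_num)]
      push_cast
      rfl
    rw [h₂] at h₁
    have hbp : 0 < b ^ p := by positivity
    have h2 : (0 : ℝ) < 2 ^ ((k + 1 : ℝ) * p) := by positivity
    have h₃ : ((t.map (level G b k)).count : ℝ) * (2 ^ ((k + 1 : ℝ) * p))⁻¹ ≤ 1 := by
      refine le_of_mul_le_mul_left ?_ hbp
      linarith
    rwa [← div_eq_mul_inv, div_le_one h2] at h₃
  have hall : (t.map (level G b k)).All (G · ≤ ENNReal.ofReal (b * 2⁻¹ ^ k)) := by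
    refine All.map (P := fun _ => True) (fun x _ => ?_) (all_of_forall (fun _ => trivial) t)
    unfold level
    split_ifs with hx
    · exact hx.2
    · simp [hG]
  obtain ⟨t', hdepth, hall', ht'⟩ := exists_depth_le_count N _ (0 : E) hall
  set M : ℝ := 2 ^ ((k + 1 : ℝ) * p) with hM
  have hM1 : 1 ≤ M := Real.one_le_rpow (by norm_num) (by positivity)
  set n : ℕ := max (t.map (level G b k)).count 1 with hn
  have hnM : (n : ℝ) + 1 ≤ 2 * M := by
    have : (n : ℝ) ≤ M := by
      rw [hn, Nat.cast_max]
      exact max_le hcount (by simpa using hM1)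
    linarith
  refine ht'.trans ((h n t' _ (le_max_right _ _) (hdepth.trans (le_max_left _ _)) hall').trans ?_)
  rw [← ENNReal.ofReal_mul (by positivity)]
  refine ENNReal.ofReal_le_ofReal ?_
  have hr0 : 0 < r := by linarith
  have hpow : ((n : ℝ) + 1) ^ (1 / r) ≤ 4 * 2 ^ (k * p / r) := by
    calc ((n : ℝ) + 1) ^ (1 / r) ≤ (2 * M) ^ (1 / r) :=
          Real.rpow_le_rpow (by positivity) hnM (by positivity)
      _ = 2 ^ ((1 + (k + 1) * p) * (1 / r)) := by
          rw [Real.rpow_mul (by norm_num), Real.rpow_add (by norm_num), Real.rpow_one, hM]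
      _ ≤ 2 ^ (2 + k * p / r) := by
          refine Real.rpow_le_rpow_of_exponent_le (by norm_num) ?_
          have h₁ : (1 + p) / r ≤ 2 := by rw [div_le_iff₀ hr0]; linarith
          have h₂ : (1 + (k + 1) * p) * (1 / r) = (1 + p) / r + k * p / r := by ring
          linarith
      _ = 4 * 2 ^ (k * p / r) := by
          rw [Real.rpow_add (by norm_num)]
          norm_num
  have hρ : ((2 : ℝ)⁻¹ ^ (1 - p / r)) ^ k = 2 ^ (k * p / r) * 2⁻¹ ^ k := by
    rw [← Real.rpow_natCast, ← Real.rpow_mul (by norm_num), Real.inv_rpow (by norm_num),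
      ← Real.rpow_natCast, Real.inv_rpow (by norm_num), ← Real.rpow_neg (by norm_num),
      ← Real.rpow_neg (by norm_num), ← Real.rpow_add (by norm_num)]
    congr 1
    ring
  rw [hρ]
  calc D * ((n : ℝ) + 1) ^ (1 / r) * (b * 2⁻¹ ^ k)
      ≤ D * (4 * 2 ^ (k * p / r)) * (b * 2⁻¹ ^ k) := by gcongr
    _ = _ := by ring

/-- If the sum of `‖xᵢ‖ ^ p` is at most `b ^ p` on every path, then the first moment of the
martingale is at most a multiple of `b`: apply the growth bound to the increments of each dyadic
level, and sum the resulting geometric series. -/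
theorem expect_le_of_maxCost_le (h : GrowthBound N G r D) (hN : EvenSubadditive N) (hG : G 0 = 0)
    (hr : 1 < r) (hr2 : r ≤ 2) (hD : 0 < D) {p b : ℝ} (hp : 0 < p) (hpr : p < r) (hb : 0 < b)
    {t : SignTree E} (ht : t.maxCost (fun x => G x ^ p) ≤ ENNReal.ofReal b ^ p) :
    expect (· + ·) N t 0 ≤ ENNReal.ofReal (16 * D / (r - p) * b) := by
  have hr0 : 0 < r := by linarith
  have hmap : t.map (lowLevels G b 0) = t := by
    refine map_eq_self ((all_of_maxCost_le ht).mono fun x hx => ?_)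
    have : G x ≤ ENNReal.ofReal b := (ENNReal.rpow_le_rpow_iff hp).1 hx
    simp [lowLevels, this]
  set ρ : ℝ := (2 : ℝ)⁻¹ ^ (1 - p / r) with hρ
  have hρ0 : 0 ≤ ρ := by positivity
  have hρ1 : (r - p) / 4 ≤ 1 - ρ := by
    have hu0 : 0 ≤ 1 - p / r := by
      have := (div_lt_one hr0).2 hpr
      linarith
    have hu1 : 1 - p / r ≤ 1 := by
      have : 0 < p / r := by positivity
      linarith
    have h₁ := rpow_one_add_le_one_add_mul_self (s := -(1 / 2)) (by norm_num) hu0 hu1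
    have h₂ : (1 + -(1 / 2) : ℝ) = 2⁻¹ := by norm_num
    rw [h₂, ← hρ] at h₁
    have h₃ : (r - p) / 2 ≤ 1 - p / r := by
      have : 1 - p / r = (r - p) / r := by field_simp
      rw [this]
      exact div_le_div_of_nonneg_left (by linarith) hr0 hr2
    linarith
  have hρlt : ρ < 1 := by linarith
  have hsum : ∀ K : ℕ, ∑ k ∈ Finset.range K, expect (· + ·) N (t.map (level G b k)) 0 ≤
      ENNReal.ofReal (16 * D / (r - p) * b) := by
    intro K
    calc _ ≤ ∑ k ∈ Finset.range K, ENNReal.ofReal (4 * D * b * ρ ^ k) :=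
          Finset.sum_le_sum fun k _ => expect_map_level_le h hG hr hD hp hpr hb ht k
      _ = ENNReal.ofReal (4 * D * b * ∑ k ∈ Finset.range K, ρ ^ k) := by
          rw [← ENNReal.ofReal_sum_of_nonneg (fun k _ => by positivity), Finset.mul_sum]
      _ ≤ _ := by
          refine ENNReal.ofReal_le_ofReal ?_
          have h₁ : ∑ k ∈ Finset.range K, ρ ^ k ≤ (1 - ρ)⁻¹ := by
            rw [← tsum_geometric_of_lt_one hρ0 hρlt]
            exact (summable_geometric_of_lt_one hρ0 hρlt).sum_le_tsum _
              fun k _ => pow_nonneg hρ0 k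
          have h₂ : (1 - ρ)⁻¹ ≤ ((r - p) / 4)⁻¹ := inv_anti₀ (by linarith) hρ1
          calc 4 * D * b * ∑ k ∈ Finset.range K, ρ ^ k ≤ 4 * D * b * ((r - p) / 4)⁻¹ := by
                gcongr
                exact h₁.trans h₂
            _ = _ := by rw [inv_div]; ring
  have hrest : ∀ K : ℕ, expect (· + ·) N (t.map (lowLevels G b K)) 0 ≤
      ENNReal.ofReal (D * (((t.depth + 1 : ℕ) : ℝ) + 1) ^ (1 / r) * (b * 2⁻¹ ^ K)) := by
    intro K
    rw [ENNReal.ofReal_mul (by positivity)]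
    refine h _ _ _ (Nat.le_add_left _ _) (by rw [depth_map]; exact Nat.le_succ _) ?_
    refine All.map (P := fun _ => True) (fun x _ => ?_) (all_of_forall (fun _ => trivial) t)
    unfold lowLevels
    split_ifs with hx
    · exact hx
    · simp [hG]
  have hlim : Filter.Tendsto (fun K : ℕ => ENNReal.ofReal (16 * D / (r - p) * b) +
      ENNReal.ofReal (D * (((t.depth + 1 : ℕ) : ℝ) + 1) ^ (1 / r) * (b * 2⁻¹ ^ K)))
      Filter.atTop (nhds (ENNReal.ofReal (16 * D / (r - p) * b) + ENNReal.ofReal 0)) := by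
    refine tendsto_const_nhds.add (ENNReal.tendsto_ofReal ?_)
    have := tendsto_pow_atTop_nhds_zero_of_lt_one (r := (2 : ℝ)⁻¹) (by norm_num) (by norm_num)
    simpa using (this.const_mul b).const_mul (D * (((t.depth + 1 : ℕ) : ℝ) + 1) ^ (1 / r))
  rw [ENNReal.ofReal_zero, add_zero] at hlim
  refine ge_of_tendsto' hlim fun K => ?_
  have := expect_map_lowLevels_le (G := G) hN hb t K
  rw [hmap] at this
  exact this.trans (add_le_add (hsum K) (hrest K))

end SignTree

/-! ### The good-`λ` inequality -/

namespace SignTree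

variable {E : Type*} [AddCommGroup E] {N G : E → ℝ≥0∞} {r D p : ℝ}

/-- The step of a martingale that also records, next to its value, the maximum of `N` and the sum
of the `p`-th powers of `G` of the increments so far. -/
def track (N G : E → ℝ≥0∞) (p : ℝ) (a : E × ℝ≥0∞ × ℝ≥0∞) (x : E) : E × ℝ≥0∞ × ℝ≥0∞ :=
  (a.1 + x, max a.2.1 (N (a.1 + x)), a.2.2 + G x ^ p)

theorem expect_le_expect_track_max (hp : 0 ≤ p) :
    ∀ (t : SignTree E) (y : E) (m s : ℝ≥0∞), N y ≤ m →
      expect (· + ·) (fun v => N v ^ p) t y ≤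
        expect (track N G p) (fun a => a.2.1 ^ p) t (y, m, s)
  | leaf, y, m, s, h => ENNReal.rpow_le_rpow h hp
  | node x l r, y, m, s, h => by
    simp only [expect]
    gcongr
    · exact expect_le_expect_track_max hp l _ _ _ (le_max_right _ _)
    · exact expect_le_expect_track_max hp r _ _ _ (le_max_right _ _)

theorem le_expect_track_cost (t : SignTree E) (y : E) (m s : ℝ≥0∞) :
    s ≤ expect (track N G p) (fun a => a.2.2) t (y, m, s) :=
  (expect_const s t (y, m, s)).symm.trans_le <|
    expect_mono_of_invariant (step := track N G p) (I := fun a => s ≤ a.2.2)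
      (fun _ _ h => h.trans le_self_add) (fun _ h => h) t (y, m, s) (le_refl s)

theorem expect_track_max_ne_top (hadd : ∀ x y, N (x + y) ≤ N x + N y) (hp : 0 < p)
    (hNG : ∀ x, G x ≠ ∞ → N x ≠ ∞) :
    ∀ (t : SignTree E) (y : E) (m s : ℝ≥0∞), N y ≠ ∞ → m ≠ ∞ →
      expect (track N G p) (fun a => a.2.2) t (y, m, s) ≠ ∞ →
      expect (track N G p) (fun a => a.2.1 ^ p) t (y, m, s) ≠ ∞
  | leaf, y, m, s, _, hm, _ => ENNReal.rpow_ne_top_of_nonneg hp.le hm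
  | node x l r, y, m, s, hy, hm, hs => by
    simp only [expect] at hs ⊢
    have hs' := (ENNReal.add_lt_top.1 (lt_top_iff_ne_top.2 fun h =>
      hs (by rw [h, ENNReal.top_div_of_ne_top (by norm_num)])))
    -- A child of finite expected cost has a label of finite size.
    have key : ∀ (z : E) (t : SignTree E),
        expect (track N G p) (fun a => a.2.2) t (track N G p (y, m, s) z) < ∞ →
          N (y + z) ≠ ∞ ∧ max m (N (y + z)) ≠ ∞ := by
      intro z t h
      have h₁ : G z ^ p < ∞ := (le_add_self.trans (le_expect_track_cost t _ _ _)).trans_lt h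
      have h₂ : N z ≠ ∞ := hNG z fun h => by
        rw [h, ENNReal.top_rpow_of_pos hp] at h₁
        exact lt_irrefl _ h₁
      have h₃ : N (y + z) ≠ ∞ := ne_top_of_le_ne_top (ENNReal.add_ne_top.2 ⟨hy, h₂⟩) (hadd y z)
      exact ⟨h₃, max_ne_top hm h₃⟩
    have hl := key x l hs'.1
    have hr := key (-x) r hs'.2
    refine (ENNReal.div_lt_top (ENNReal.add_ne_top.2 ⟨?_, ?_⟩) (by norm_num)).ne
    · exact expect_track_max_ne_top hadd hp hNG l _ _ _ hl.1 hl.2 hs'.1.ne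
    · exact expect_track_max_ne_top hadd hp hNG r _ _ _ hr.1 hr.2 hs'.2.ne

section Indicators

open Classical

theorem expect_track_eq_zero {B T : ℝ≥0∞} (t : SignTree E) {a : E × ℝ≥0∞ × ℝ≥0∞}
    (ha : B < a.2.2) :
    expect (track N G p) (fun a => if T < a.2.1 ∧ a.2.2 ≤ B then 1 else 0) t a = 0 :=
  expect_eq_const_of_invariant (I := fun a => B < a.2.2)
    (fun _ _ h => h.trans_le le_self_add) 0 (fun a h => by simp [h.not_ge]) t a ha

theorem expect_ite_le_one {σ : Type*} {step : σ → E → σ} (P : σ → Prop) [DecidablePred P]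
    (t : SignTree E) (a : σ) :
    expect step (fun a => if P a then 1 else 0) t a ≤ 1 :=
  (expect_mono (ψ := fun _ => 1) (fun a => by split_ifs <;> simp) t a).trans_eq (expect_const 1 t a)

/-- Stopping a martingale when `N` passes `T`, and before the cost exceeds `B`. -/
theorem exists_stopped (hG : ∀ x, G (-x) = G x) {B T : ℝ≥0∞} :
    ∀ (t : SignTree E) (y : E) (m s : ℝ≥0∞), s ≤ B → (m ≤ T ∨ T < N y) →
      ∃ t' : SignTree E, s + t'.maxCost (fun x => G x ^ p) ≤ B ∧
        expect (track N G p) (fun a => if T < a.2.1 ∧ a.2.2 ≤ B then 1 else 0) t (y, m, s) ≤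
          expect (· + ·) (fun v => if T < N v then 1 else 0) t' y
  | leaf, y, m, s, hs, hm => by
    refine ⟨leaf, by simpa [maxCost] using hs, ?_⟩
    rcases hm with hm | hm
    · simp [expect, hm.not_gt]
    · simp only [expect, hm, if_true]
      split_ifs <;> simp
  | node x l r, y, m, s, hs, hm => by
    by_cases hy : T < N y
    · refine ⟨leaf, by simpa [maxCost] using hs, (expect_ite_le_one _ _ _).trans ?_⟩
      simp [expect, hy]
    by_cases hx : s + G x ^ p ≤ B
    · have hm' : ∀ z, max m (N (y + z)) ≤ T ∨ T < N (y + z) := fun z => by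
        rw [max_le_iff]
        exact (le_or_gt (N (y + z)) T).imp_left fun h => ⟨hm.resolve_right hy, h⟩
      obtain ⟨l', hl, hl'⟩ := exists_stopped hG l (y + x) (max m (N (y + x))) (s + G x ^ p) hx
        (hm' x)
      obtain ⟨r', hr, hr'⟩ := exists_stopped hG (B := B) r (y + -x) (max m (N (y + -x)))
        (s + G (-x) ^ p) (by rw [hG]; exact hx) (hm' (-x))
      refine ⟨node x l' r', ?_, ?_⟩
      · rw [hG] at hr
        rw [maxCost, ← add_assoc]
        rcases le_total (l'.maxCost fun x => G x ^ p) (r'.maxCost fun x => G x ^ p) with h | h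
        · rwa [max_eq_right h]
        · rwa [max_eq_left h]
      · simp only [expect]
        gcongr
        · exact hl'
        · exact hr'
    · refine ⟨leaf, by simpa [maxCost] using hs, ?_⟩
      have hl : B < (track N G p (y, m, s) x).2.2 := not_le.1 hx
      have hr : B < (track N G p (y, m, s) (-x)).2.2 := by simpa [track, hG] using hx
      simp only [expect]
      rw [expect_track_eq_zero l hl, expect_track_eq_zero r hr]
      simp

/-- The cost bound in the good event, as a fraction of the level. With it the first moment of a
martingale within the cost bound is at most `1 / 16` of the level. -/
def goodRatio (r D p : ℝ) : ℝ := (r - p) / (256 * D)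

variable (hgrowth : GrowthBound N G r D) (hN : EvenSubadditive N) (hG0 : G 0 = 0)
  (hG : ∀ x, G (-x) = G x) (hr : 1 < r) (hr2 : r ≤ 2) (hD : 0 < D) (hp : 0 < p) (hpr : p < r)

include hgrowth hN hG0 hG hr hr2 hD hp hpr

/-- Starting at a point slightly above level `L`, the martingale rarely gets to level `2 L` at a
cost of at most `δ L`: stop it there, and apply Markov's inequality. -/
theorem expect_track_le_of_near {L : ℝ} (hL : 0 < L) (t : SignTree E) (y : E) (s : ℝ≥0∞)
    (hy : N y ≤ ENNReal.ofReal (65 / 64 * L)) :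
    expect (track N G p) (fun a => if ENNReal.ofReal (2 * L) < a.2.1 ∧
      a.2.2 ≤ ENNReal.ofReal (goodRatio r D p * L) ^ p then 1 else 0) t (y, N y, s) ≤ 1 / 8 := by
  have hrp : 0 < r - p := by linarith
  have hδ : 0 < goodRatio r D p := by unfold goodRatio; positivity
  set B := ENNReal.ofReal (goodRatio r D p * L) ^ p with hB
  by_cases hs : s ≤ B
  swap
  · rw [expect_track_eq_zero t (not_le.1 hs)]
    exact zero_le
  obtain ⟨t', ht', hle⟩ := exists_stopped (N := N) (p := p) hG (B := B)
    (T := ENNReal.ofReal (2 * L)) t y (N y) s hs (le_or_gt _ _)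
  refine hle.trans ?_
  have h₁ := expect_le_of_maxCost_le hgrowth hN hG0 hr hr2 hD hp hpr (mul_pos hδ hL)
    (le_add_self.trans ht')
  have h₂ : N y + ENNReal.ofReal (63 / 64 * L) ≤ ENNReal.ofReal (2 * L) := by
    calc _ ≤ ENNReal.ofReal (65 / 64 * L) + ENNReal.ofReal (63 / 64 * L) := by gcongr
      _ = _ := by rw [← ENNReal.ofReal_add (by positivity) (by positivity)]; ring_nf
  have h₃ := expect_indicator_le hN.add_le (by simpa using hL) ENNReal.ofReal_ne_top
    (ne_top_of_le_ne_top ENNReal.ofReal_ne_top hy) h₂ t' 0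
  rw [add_zero] at h₃
  refine h₃.trans ((ENNReal.div_le_div_right h₁ _).trans ?_)
  rw [← ENNReal.ofReal_div_of_pos (by positivity)]
  have h₄ : (1 / 8 : ℝ≥0∞) = ENNReal.ofReal (1 / 8) := by
    rw [ENNReal.ofReal_div_of_pos (by norm_num)]
    simp
  rw [h₄]
  refine ENNReal.ofReal_le_ofReal ?_
  have h₅ : 16 * D / (r - p) * (goodRatio r D p * L) = L / 16 := by
    unfold goodRatio
    field_simp
    norm_num
  rw [h₅, div_le_iff₀ (by positivity)]
  linarith

/-- From a value of `N` at most `L`, the event of getting to `2 L` at a cost of at most `δ L` has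
at most `1 / 8` of the probability of getting to `L`. -/
theorem expect_track_le_mul_of_le {L : ℝ} (hL : 0 < L) :
    ∀ (t : SignTree E) (y : E) (m s : ℝ≥0∞), N y ≤ m → m ≤ ENNReal.ofReal L →
      expect (track N G p) (fun a => if ENNReal.ofReal (2 * L) < a.2.1 ∧
        a.2.2 ≤ ENNReal.ofReal (goodRatio r D p * L) ^ p then 1 else 0) t (y, m, s) ≤
      1 / 8 * expect (track N G p) (fun a => if ENNReal.ofReal L < a.2.1 then 1 else 0) t (y, m, s)
  | leaf, y, m, s, hy, hm => by
    have h : ENNReal.ofReal L ≤ ENNReal.ofReal (2 * L) := ENNReal.ofReal_le_ofReal (by linarith)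
    generalize ENNReal.ofReal (2 * L) = T at h
    simp [expect, (hm.trans h).not_gt]
  | node x l r', y, m, s, hy, hm => by
    have hrp : 0 < r - p := by linarith
    have hδ : 0 < goodRatio r D p := by unfold goodRatio; positivity
    have key : ∀ (z : E) (t : SignTree E),
        (∀ (m' s' : ℝ≥0∞), N (y + z) ≤ m' → m' ≤ ENNReal.ofReal L →
          expect (track N G p) (fun a => if ENNReal.ofReal (2 * L) < a.2.1 ∧
            a.2.2 ≤ ENNReal.ofReal (goodRatio r D p * L) ^ p then 1 else 0) t (y + z, m', s') ≤
          1 / 8 * expect (track N G p) (fun a => if ENNReal.ofReal L < a.2.1 then 1 else 0) t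
            (y + z, m', s')) →
        expect (track N G p) (fun a => if ENNReal.ofReal (2 * L) < a.2.1 ∧
          a.2.2 ≤ ENNReal.ofReal (goodRatio r D p * L) ^ p then 1 else 0) t
            (track N G p (y, m, s) z) ≤
        1 / 8 * expect (track N G p) (fun a => if ENNReal.ofReal L < a.2.1 then 1 else 0) t
          (track N G p (y, m, s) z) := by
      intro z t ih
      by_cases hz : N (y + z) ≤ ENNReal.ofReal L
      · exact ih _ _ (le_max_right _ _) (max_le hm hz)
      by_cases hs : s + G z ^ p ≤ ENNReal.ofReal (goodRatio r D p * L) ^ p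
      swap
      · rw [expect_track_eq_zero t (not_le.1 hs)]
        exact zero_le
      have hone : expect (track N G p) (fun a => if ENNReal.ofReal L < a.2.1 then 1 else 0) t
          (track N G p (y, m, s) z) = 1 :=
        expect_eq_const_of_invariant (I := fun a => ENNReal.ofReal L < a.2.1)
          (fun a x h => h.trans_le (le_max_left _ _)) 1 (fun a h => by simp [h]) t _
          ((not_le.1 hz).trans_le (le_max_right _ _))
      rw [hone, mul_one]
      have hGz : G z ≤ ENNReal.ofReal (goodRatio r D p * L) :=
        (ENNReal.rpow_le_rpow_iff hp).1 (le_add_self.trans hs)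
      -- The last increment is too small to overshoot the level by much.
      have hNz : N (y + z) ≤ ENNReal.ofReal (65 / 64 * L) := by
        calc N (y + z) ≤ N y + N z := hN.add_le _ _
          _ ≤ ENNReal.ofReal L +
              ENNReal.ofReal (2 * D) * ENNReal.ofReal (goodRatio r D p * L) := by
            refine add_le_add (hy.trans hm) ((hgrowth.apply_le hN hr hD z).trans ?_)
            gcongr
          _ ≤ _ := by
            rw [← ENNReal.ofReal_mul (by positivity),
              ← ENNReal.ofReal_add (by positivity) (by positivity)]
            refine ENNReal.ofReal_le_ofReal ?_
            have : 2 * D * (goodRatio r D p * L) = (r - p) / 128 * L := by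
              unfold goodRatio
              field_simp
              norm_num
            rw [this]
            nlinarith
      have hmax : track N G p (y, m, s) z = (y + z, N (y + z), s + G z ^ p) := by
        simp only [track, max_eq_right (hm.trans (not_le.1 hz).le)]
      rw [hmax]
      exact expect_track_le_of_near hgrowth hN hG0 hG hr hr2 hD hp hpr hL t _ _ hNz
    simp only [expect, ← mul_div_assoc, mul_add]
    gcongr
    · exact key x l (expect_track_le_mul_of_le hL l _)
    · exact key (-x) r' (expect_track_le_mul_of_le hL r' _)

/-- The good-`λ` inequality. -/
theorem expect_track_good_lambda {L : ℝ} (hL : 0 < L) (t : SignTree E) (x : E) :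
    expect (track N G p) (fun a => if ENNReal.ofReal (2 * L) < a.2.1 then 1 else 0) t
        (x, N x, G x ^ p) ≤
      1 / 8 * expect (track N G p) (fun a => if ENNReal.ofReal L < a.2.1 then 1 else 0) t
          (x, N x, G x ^ p) +
        expect (track N G p)
          (fun a => if ENNReal.ofReal (goodRatio r D p * L) ^ p < a.2.2 then 1 else 0) t
          (x, N x, G x ^ p) := by
  have hrp : 0 < r - p := by linarith
  have hδ : 0 < goodRatio r D p := by unfold goodRatio; positivity
  calc _ ≤ expect (track N G p) (fun a => (if ENNReal.ofReal (2 * L) < a.2.1 ∧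
        a.2.2 ≤ ENNReal.ofReal (goodRatio r D p * L) ^ p then 1 else 0) +
        (if ENNReal.ofReal (goodRatio r D p * L) ^ p < a.2.2 then 1 else 0)) t
          (x, N x, G x ^ p) := by
        refine expect_mono (fun a => ?_) t _
        generalize ENNReal.ofReal (2 * L) = T
        by_cases h₁ : T < a.2.1
        · by_cases h₂ : a.2.2 ≤ ENNReal.ofReal (goodRatio r D p * L) ^ p
          · simp [h₁, h₂]
          · simp [h₁, not_le.1 h₂]
        · simp [h₁]
    _ ≤ _ := by
        rw [expect_add]
        gcongr
        by_cases hx : N x ≤ ENNReal.ofReal L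
        · exact expect_track_le_mul_of_le hgrowth hN hG0 hG hr hr2 hD hp hpr hL t x _ _ le_rfl hx
        · -- A start above level `L` is itself too costly.
          rw [expect_track_eq_zero t]
          · exact zero_le
          refine ENNReal.rpow_lt_rpow (lt_of_not_ge fun h => hx ?_) hp
          refine (hgrowth.apply_le hN hr hD x).trans ((mul_le_mul_right h _).trans ?_)
          rw [← ENNReal.ofReal_mul (by positivity)]
          refine ENNReal.ofReal_le_ofReal ?_
          have : 2 * D * (goodRatio r D p * L) = (r - p) / 128 * L := by
            unfold goodRatio
            field_simp
            norm_num
          rw [this]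
          nlinarith

end Indicators

end SignTree

/-! ### From the good-`λ` inequality to moments -/

open MeasureTheory in
open Classical in
/-- The layer-cake formula for a single value `a`, which may be infinite. -/
theorem lintegral_rpow_ite_lt {p : ℝ} (hp : 0 < p) (a : ℝ≥0∞) :
    ∫⁻ u in Set.Ioi (0 : ℝ), ENNReal.ofReal (p * u ^ (p - 1)) *
      (if ENNReal.ofReal u < a then 1 else 0) = a ^ p := by
  have hfin : ∀ b : ℝ, 0 ≤ b → ∫⁻ u in Set.Ioi (0 : ℝ), ENNReal.ofReal (p * u ^ (p - 1)) *
      (if ENNReal.ofReal u < ENNReal.ofReal b then 1 else 0) = ENNReal.ofReal b ^ p := by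
    intro b hb
    have h₁ : ∀ u ∈ Set.Ioi (0 : ℝ), ENNReal.ofReal (p * u ^ (p - 1)) *
        (if ENNReal.ofReal u < ENNReal.ofReal b then 1 else 0) =
        (Set.Iio b).indicator (fun u => ENNReal.ofReal (p * u ^ (p - 1))) u := by
      intro u hu
      simp only [Set.indicator, Set.mem_Iio, ENNReal.ofReal_lt_ofReal_iff_of_nonneg (le_of_lt hu)]
      split_ifs <;> simp
    rw [setLIntegral_congr_fun measurableSet_Ioi h₁, lintegral_indicator measurableSet_Iio,
      Measure.restrict_restrict measurableSet_Iio, Set.inter_comm, Set.Ioi_inter_Iio,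
      restrict_Ioo_eq_restrict_Ioc, ← ofReal_integral_eq_lintegral_ofReal]
    · rw [← intervalIntegral.integral_of_le hb, intervalIntegral.integral_const_mul,
        integral_rpow (.inl (by linarith)), sub_add_cancel, Real.zero_rpow hp.ne', sub_zero,
        mul_div_cancel₀ _ hp.ne', ENNReal.ofReal_rpow_of_nonneg hb hp.le]
    · exact ((intervalIntegral.intervalIntegrable_rpow' (by linarith)).const_mul p).1
    · refine (ae_restrict_mem measurableSet_Ioc).mono fun u hu => ?_
      have : 0 < u := hu.1
      simp only [Pi.zero_apply]
      positivity
  rcases eq_or_ne a ∞ with rfl | ha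
  · rw [ENNReal.top_rpow_of_pos hp]
    refine ENNReal.eq_top_of_forall_nnreal_le fun c => ?_
    have h := hfin ((c : ℝ) ^ p⁻¹) (by positivity)
    rw [ENNReal.ofReal_rpow_of_nonneg (by positivity) hp.le,
      Real.rpow_inv_rpow c.coe_nonneg hp.ne', ENNReal.ofReal_coe_nnreal] at h
    rw [← h]
    gcongr with u
    split_ifs <;> simp_all
  · rw [← ENNReal.ofReal_toReal ha]
    exact hfin _ ENNReal.toReal_nonneg

namespace SignTree

variable {E : Type*} [AddCommGroup E] {N G : E → ℝ≥0∞} {r D p : ℝ}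

open MeasureTheory in
open Classical in
/-- The layer-cake formula for the `p`-th moment of `f`. -/
theorem lintegral_expect_ite_lt {σ : Type*} {step : σ → E → σ} (hp : 0 < p) (f : σ → ℝ≥0∞)
    (t : SignTree E) (a : σ) :
    ∫⁻ u in Set.Ioi (0 : ℝ), ENNReal.ofReal (p * u ^ (p - 1)) *
      expect step (fun a => if ENNReal.ofReal u < f a then 1 else 0) t a =
    expect step (fun a => f a ^ p) t a := by
  simp only [← expect_const_mul]
  rw [lintegral_expect]
  · simp only [lintegral_rpow_ite_lt hp]
  · intro a
    refine (by fun_prop : Measurable fun u : ℝ => ENNReal.ofReal (p * u ^ (p - 1))).mul ?_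
    exact Measurable.ite (measurableSet_lt ENNReal.measurable_ofReal measurable_const)
      measurable_const measurable_const

open MeasureTheory in
open Classical in
/-- The good-`λ` inequality, multiplied by `p λ ^ (p - 1)` and integrated over all levels `λ`. -/
theorem expect_half_max_rpow_le (hgrowth : GrowthBound N G r D) (hN : EvenSubadditive N)
    (hG0 : G 0 = 0) (hG : ∀ x, G (-x) = G x) (hr : 1 < r) (hr2 : r ≤ 2) (hD : 0 < D) (hp : 0 < p)
    (hpr : p < r) (t : SignTree E) (x : E) :
    expect (track N G p) (fun a => (a.2.1 / 2) ^ p) t (x, N x, G x ^ p) ≤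
      1 / 8 * expect (track N G p) (fun a => a.2.1 ^ p) t (x, N x, G x ^ p) +
        (ENNReal.ofReal (goodRatio r D p) ^ p)⁻¹ *
          expect (track N G p) (fun a => a.2.2) t (x, N x, G x ^ p) := by
  have hrp : 0 < r - p := by linarith
  have hδ : 0 < goodRatio r D p := by unfold goodRatio; positivity
  set δ := goodRatio r D p with hδ_def
  have hδ0 : ENNReal.ofReal δ ≠ 0 := by simpa using hδ
  have hcost : ∀ a : E × ℝ≥0∞ × ℝ≥0∞,
      (ENNReal.ofReal δ ^ p)⁻¹ * a.2.2 = (a.2.2 ^ p⁻¹ / ENNReal.ofReal δ) ^ p := fun a => by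
    rw [ENNReal.div_rpow_of_nonneg _ _ hp.le, ENNReal.rpow_inv_rpow hp.ne', div_eq_mul_inv,
      mul_comm]
  rw [← expect_const_mul (ENNReal.ofReal δ ^ p)⁻¹]
  simp only [hcost]
  rw [← lintegral_expect_ite_lt hp, ← lintegral_expect_ite_lt hp (fun a : E × ℝ≥0∞ × ℝ≥0∞ => a.2.1),
    ← lintegral_expect_ite_lt hp (fun a : E × ℝ≥0∞ × ℝ≥0∞ => a.2.2 ^ p⁻¹ / ENNReal.ofReal δ),
    ← lintegral_const_mul' _ _ (by norm_num), ← lintegral_add_right']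
  · refine setLIntegral_mono' measurableSet_Ioi fun u (hu : 0 < u) => ?_
    have h := expect_track_good_lambda hgrowth hN hG0 hG hr hr2 hD hp hpr hu t x
    have h₁ : ∀ a : E × ℝ≥0∞ × ℝ≥0∞,
        ENNReal.ofReal (2 * u) < a.2.1 ↔ ENNReal.ofReal u < a.2.1 / 2 := fun a => by
      rw [ENNReal.lt_div_iff_mul_lt (by simp) (by simp), ENNReal.ofReal_mul (by norm_num),
        mul_comm, ENNReal.ofReal_ofNat]
    have h₂ : ∀ a : E × ℝ≥0∞ × ℝ≥0∞,
        ENNReal.ofReal (δ * u) ^ p < a.2.2 ↔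
          ENNReal.ofReal u < a.2.2 ^ p⁻¹ / ENNReal.ofReal δ := fun a => by
      rw [ENNReal.lt_div_iff_mul_lt (.inl hδ0) (by simp), mul_comm δ,
        ← ENNReal.ofReal_mul hu.le, ENNReal.lt_rpow_inv_iff hp]
    rw [← hδ_def] at h
    simp only [h₁, h₂] at h
    refine (mul_le_mul_right h _).trans_eq ?_
    ring
  · refine (Measurable.mul (by fun_prop) (measurable_expect (fun a => ?_) t _)).aemeasurable
    exact Measurable.ite (measurableSet_lt ENNReal.measurable_ofReal measurable_const)
      measurable_const measurable_const

/-- The martingale type inequality along sign trees, for exponents `1 ≤ p < r`. -/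
theorem expect_rpow_le_of_one_le (hgrowth : GrowthBound N G r D) (hN : EvenSubadditive N)
    (hG0 : G 0 = 0) (hG : ∀ x, G (-x) = G x) (hr : 1 < r) (hr2 : r ≤ 2) (hD : 0 < D) (hp : 1 ≤ p)
    (hpr : p < r) (t : SignTree E) (x : E) :
    expect (· + ·) (fun v => N v ^ p) t x ≤ ENNReal.ofReal (1024 * D / (r - p)) ^ p *
      expect (track N G p) (fun a => a.2.2) t (x, N x, G x ^ p) := by
  have hp0 : 0 < p := by linarith
  have hrp : 0 < r - p := by linarith
  have hδ : 0 < goodRatio r D p := by unfold goodRatio; positivity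
  set S := expect (track N G p) (fun a => a.2.2) t (x, N x, G x ^ p) with hS
  refine (expect_le_expect_track_max (G := G) hp0.le t x (N x) (G x ^ p) le_rfl).trans ?_
  set Q := expect (track N G p) (fun a => a.2.1 ^ p) t (x, N x, G x ^ p) with hQ
  by_cases hStop : S = ∞
  · rw [hStop, ENNReal.mul_top]
    · exact le_top
    · refine (ENNReal.rpow_pos ?_ ENNReal.ofReal_ne_top).ne'
      simp only [ENNReal.ofReal_pos]
      positivity
  have hNG : ∀ z, G z ≠ ∞ → N z ≠ ∞ := fun z hz =>
    ne_top_of_le_ne_top (ENNReal.mul_ne_top ENNReal.ofReal_ne_top hz) (hgrowth.apply_le hN hr hD z)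
  have hNx : N x ≠ ∞ := hNG x fun h => hStop <| top_le_iff.1 <|
    (by rw [h, ENNReal.top_rpow_of_pos hp0] : G x ^ p = ∞).symm.trans_le
      (le_expect_track_cost t x (N x) (G x ^ p))
  have hQtop : Q ≠ ∞ := expect_track_max_ne_top hN.add_le hp0 hNG t x _ _ hNx hNx hStop
  have hmain := expect_half_max_rpow_le hgrowth hN hG0 hG hr hr2 hD hp0 hpr t x
  rw [← hQ, ← hS] at hmain
  have hhalf : Q = 2 ^ p * expect (track N G p) (fun a => (a.2.1 / 2) ^ p) t (x, N x, G x ^ p) := by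
    rw [← expect_const_mul, hQ]
    congr 1
    funext a
    rw [← ENNReal.mul_rpow_of_nonneg _ _ hp0.le, ENNReal.mul_div_cancel (by simp) (by simp)]
  set K := (ENNReal.ofReal (goodRatio r D p) ^ p)⁻¹ with hK
  have h4 : (2 : ℝ≥0∞) ^ p ≤ 4 := by
    calc (2 : ℝ≥0∞) ^ p ≤ 2 ^ (2 : ℝ) := ENNReal.rpow_le_rpow_of_exponent_le (by norm_num)
          (by linarith)
      _ = 4 := by rw [ENNReal.rpow_ofNat]; norm_num
  have h2 : (2 : ℝ≥0∞) ≤ 2 ^ p := by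
    calc (2 : ℝ≥0∞) = 2 ^ (1 : ℝ) := (ENNReal.rpow_one 2).symm
      _ ≤ _ := ENNReal.rpow_le_rpow_of_exponent_le (by norm_num) hp
  -- The factor `1 / 8` absorbs `2 ^ p ≤ 4`, and the finite `Q / 2` that is left can be cancelled.
  have habs : Q / 2 + Q / 2 ≤ Q / 2 + 2 ^ p * (K * S) := by
    rw [ENNReal.add_halves]
    calc Q ≤ 2 ^ p * (1 / 8 * Q + K * S) := by
          conv_lhs => rw [hhalf]
          gcongr
      _ = 2 ^ p * (1 / 8) * Q + 2 ^ p * (K * S) := by ring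
      _ ≤ 4 * (1 / 8) * Q + 2 ^ p * (K * S) := by gcongr
      _ = _ := by
        congr 1
        rw [ENNReal.div_eq_inv_mul (a := Q)]
        congr 1
        rw [mul_one_div, ENNReal.div_eq_inv_mul, show (8 : ℝ≥0∞) = 2 * 4 by norm_num,
          ENNReal.mul_inv (by simp) (by simp), mul_assoc,
          ENNReal.inv_mul_cancel (by simp) (by simp), mul_one]
  have habs' : Q / 2 ≤ 2 ^ p * (K * S) :=
    (ENNReal.add_le_add_iff_left (ENNReal.div_ne_top hQtop (by simp))).1 habs
  calc Q = 2 * (Q / 2) := (ENNReal.mul_div_cancel (by simp) (by simp)).symm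
    _ ≤ 2 ^ p * (2 ^ p * (K * S)) := by gcongr
    _ = 2 ^ p * 2 ^ p * K * S := by ring
    _ = _ := by
      congr 1
      rw [hK, ← ENNReal.inv_rpow, ← ENNReal.mul_rpow_of_nonneg _ _ hp0.le,
        ← ENNReal.mul_rpow_of_nonneg _ _ hp0.le, ← ENNReal.ofReal_inv_of_pos hδ,
        ← ENNReal.ofReal_ofNat, ← ENNReal.ofReal_mul (by norm_num),
        ← ENNReal.ofReal_mul (by norm_num)]
      congr 2
      unfold goodRatio
      rw [inv_div]
      ring

/-- The martingale type inequality along sign trees, for exponents `p ≤ 1`. Here `p`-th powers are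
subadditive, so that the single increments can be estimated. -/
theorem expect_rpow_le_of_le_one (hgrowth : GrowthBound N G r D) (hN : EvenSubadditive N)
    (hr : 1 < r) (hD : 0 < D) (hp : 0 < p) (hp1 : p ≤ 1) (t : SignTree E) (x : E) :
    expect (· + ·) (fun v => N v ^ p) t x ≤ ENNReal.ofReal (2 * D) ^ p *
      expect (track N G p) (fun a => a.2.2) t (x, N x, G x ^ p) := by
  have hstep : ∀ z, N z ^ p ≤ ENNReal.ofReal (2 * D) ^ p * G z ^ p := fun z => by
    rw [← ENNReal.mul_rpow_of_nonneg _ _ hp.le]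
    exact ENNReal.rpow_le_rpow (hgrowth.apply_le hN hr hD z) hp.le
  have key : ∀ (t : SignTree E) (y : E) (m s : ℝ≥0∞), N y ^ p ≤ ENNReal.ofReal (2 * D) ^ p * s →
      expect (· + ·) (fun v => N v ^ p) t y ≤ ENNReal.ofReal (2 * D) ^ p *
        expect (track N G p) (fun a => a.2.2) t (y, m, s) := by
    intro t
    induction t with
    | leaf => exact fun y m s h => h
    | node z l r ihl ihr =>
      intro y m s h
      have hadd : ∀ z, N (y + z) ^ p ≤ ENNReal.ofReal (2 * D) ^ p * (s + G z ^ p) := fun z => by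
        rw [mul_add]
        exact (ENNReal.rpow_le_rpow (hN.add_le y z) hp.le).trans
          ((ENNReal.rpow_add_le_add_rpow _ _ hp.le hp1).trans (add_le_add h (hstep z)))
      simp only [expect, ← mul_div_assoc, mul_add]
      gcongr
      · exact ihl _ _ _ (hadd z)
      · exact ihr _ _ _ (hadd (-z))
  exact key t x _ _ (hstep x)

end SignTree

/-! ### Walsh–Paley martingales as sign trees -/

namespace OnlineGame

theorem sum_signs_succ {M : Type*} [AddCommMonoid M] (n : ℕ) (g : (Fin (n + 1) → ℤˣ) → M) :
    ∑ ε, g ε = ∑ ε : Fin n → ℤˣ, g (Fin.cons 1 ε) + ∑ ε : Fin n → ℤˣ, g (Fin.cons (-1) ε) := by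
  rw [← (Fin.consEquiv fun _ : Fin (n + 1) => ℤˣ).sum_comp, Fintype.sum_prod_type, UnitsInt.univ,
    Finset.sum_pair (by decide)]
  rfl

theorem signExpectation_zero (g : (Fin 0 → ℤˣ) → ℝ≥0∞) : signExpectation 0 g = g Fin.elim0 := by
  rw [signExpectation, Fintype.sum_subsingleton _ Fin.elim0]
  simp

theorem signExpectation_succ (n : ℕ) (g : (Fin (n + 1) → ℤˣ) → ℝ≥0∞) :
    signExpectation (n + 1) g = (signExpectation n (fun ε => g (Fin.cons 1 ε)) +
      signExpectation n (fun ε => g (Fin.cons (-1) ε))) / 2 := by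
  unfold signExpectation
  rw [sum_signs_succ, ← mul_add, pow_succ,
    ENNReal.mul_inv (.inr (by simp)) (.inr (by simp)), div_eq_mul_inv]
  ring

theorem signExpectation_mono {n : ℕ} {g h : (Fin n → ℤˣ) → ℝ≥0∞} (hgh : ∀ ε, g ε ≤ h ε) :
    signExpectation n g ≤ signExpectation n h := by
  unfold signExpectation
  gcongr
  exact hgh _

theorem sub_le_of_regret_le {B : Type*} {W : Set B} {F : Set (W → ℝ)} {A : Algorithm W F} {n : ℕ}
    {f : Fin n → F} {v : ℝ} (hn : 0 < n) (h : regret A n f ≤ v) (w : W) :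
    ∑ t : Fin n, (f t : W → ℝ) (A t (fun j : Fin t => f (Fin.castLE t.isLt.le j))) -
      ∑ t : Fin n, (f t : W → ℝ) w ≤ n * v := by
  have h₁ := (EReal.sub_le_sub le_rfl (iInf_le (fun w : W =>
    (((1 / (n : ℝ)) * ∑ t : Fin n, (f t : W → ℝ) w : ℝ) : EReal)) w)).trans h
  rw [← EReal.coe_sub, EReal.coe_le_coe_iff, ← mul_sub, one_div,
    inv_mul_le_iff₀ (by positivity)] at h₁
  exact h₁

variable {B : Type*} [AddCommGroup B] [Module ℝ B] [TopologicalSpace B]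

/-- The increments that follow after the first sign has come out as `e`. -/
def shift (x : Increments B) (e : ℤˣ) : Increments B := fun i ε => x (i + 1) (Fin.cons e ε)

/-- The first `n` increments of a Walsh–Paley martingale as a sign tree. -/
def ofIncrements : ℕ → Increments B → SignTree (StrongDual ℝ B)
  | 0, _ => .leaf
  | n + 1, x => .node (x 0 Fin.elim0) (ofIncrements n (shift x 1)) (ofIncrements n (shift x (-1)))

/-- A sign tree as a sequence of increments, continued by zeros. -/
def toIncrements : SignTree (StrongDual ℝ B) → Increments B
  | .leaf, _, _ => 0
  | .node x _ _, 0, _ => x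
  | .node _ l r, i + 1, ε =>
    if ε 0 = 1 then toIncrements l i (Fin.tail ε) else toIncrements r i (Fin.tail ε)

theorem shift_toIncrements_one (x : StrongDual ℝ B) (l r : SignTree (StrongDual ℝ B)) :
    shift (toIncrements (.node x l r)) 1 = toIncrements l := by
  funext i ε
  simp [shift, toIncrements]

theorem shift_toIncrements_neg_one (x : StrongDual ℝ B) (l r : SignTree (StrongDual ℝ B)) :
    shift (toIncrements (.node x l r)) (-1) = toIncrements r := by
  funext i ε
  simp [shift, toIncrements]

theorem apply_toIncrements_of_all {P : StrongDual ℝ B → Prop} (h0 : P 0) :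
    ∀ {t : SignTree (StrongDual ℝ B)}, t.All P → ∀ i ε, P (toIncrements t i ε)
  | .leaf, _, _, _ => h0
  | .node _ _ _, h, 0, _ => h.1
  | .node _ l r, h, i + 1, ε => by
    rw [toIncrements]
    split_ifs
    · exact apply_toIncrements_of_all h0 h.2.1 _ _
    · exact apply_toIncrements_of_all h0 h.2.2 _ _

theorem expect_track_ofIncrements {N G : StrongDual ℝ B → ℝ≥0∞} {p : ℝ}
    (hG : ∀ x, G (-x) = G x) :
    ∀ (n : ℕ) (x : Increments B) (y : StrongDual ℝ B) (m s : ℝ≥0∞),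
      SignTree.expect (SignTree.track N G p) (fun a => a.2.2) (ofIncrements n x) (y, m, s) =
        s + ∑ i ∈ Finset.range n, signExpectation i (fun ε => G (x i ε) ^ p)
  | 0, x, y, m, s => by simp [ofIncrements, SignTree.expect]
  | n + 1, x, y, m, s => by
    rw [Finset.sum_range_succ', signExpectation_zero]
    simp only [ofIncrements, SignTree.expect, SignTree.track, hG,
      expect_track_ofIncrements hG n, signExpectation_succ]
    simp only [div_eq_mul_inv, ← Finset.sum_mul, Finset.sum_add_distrib, shift]
    set u := s + G (x 0 Fin.elim0) ^ p
    rw [show ∀ a b : ℝ≥0∞, (u + a + (u + b)) * 2⁻¹ = u * (2 * 2⁻¹) + (a + b) * 2⁻¹ by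
      intro a b; ring, ENNReal.mul_inv_cancel (by simp) (by simp), mul_one]
    ring

theorem walshPaley_cons (x₀ : StrongDual ℝ B) (x : Increments B) (n : ℕ) (e : ℤˣ)
    (ε : Fin n → ℤˣ) :
    walshPaley x₀ x (n + 1) (Fin.cons e ε) =
      walshPaley (x₀ + ((e : ℤ) : ℝ) • x 0 Fin.elim0) (shift x e) n ε := by
  unfold walshPaley
  rw [Fin.sum_univ_succ, add_assoc]
  congr 2
  · simp only [Fin.cons_zero]
    congr 2
    exact Subsingleton.elim (α := Fin 0 → ℤˣ) _ _
  · refine Finset.sum_congr rfl fun i _ => ?_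
    simp only [Fin.cons_succ, shift]
    congr 1
    change x (i + 1) _ = x (i + 1) _
    congr 1
    funext j
    refine Fin.cases ?_ (fun j => ?_) j
    · rfl
    · simp only [Fin.cons_succ]
      rfl

theorem signExpectation_walshPaley_succ (φ : StrongDual ℝ B → ℝ≥0∞) (x₀ : StrongDual ℝ B)
    (x : Increments B) (n : ℕ) :
    signExpectation (n + 1) (fun ε => φ (walshPaley x₀ x (n + 1) ε)) =
      (signExpectation n (fun ε => φ (walshPaley (x₀ + x 0 Fin.elim0) (shift x 1) n ε)) +
        signExpectation n
          (fun ε => φ (walshPaley (x₀ + -x 0 Fin.elim0) (shift x (-1)) n ε))) / 2 := by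
  rw [signExpectation_succ]
  simp only [walshPaley_cons, Units.val_one, Units.val_neg, Int.cast_one, Int.cast_neg, one_smul]
  have h : (-1 : ℝ) • x 0 Fin.elim0 = -x 0 Fin.elim0 := by
    ext w
    simp
  rw [h]

theorem signExpectation_walshPaley_zero (φ : StrongDual ℝ B → ℝ≥0∞) (x₀ : StrongDual ℝ B)
    (x : Increments B) :
    signExpectation 0 (fun ε => φ (walshPaley x₀ x 0 ε)) = φ x₀ := by
  rw [signExpectation_zero]
  simp [walshPaley]

theorem signExpectation_walshPaley (φ : StrongDual ℝ B → ℝ≥0∞) :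
    ∀ (n : ℕ) (x : Increments B) (x₀ : StrongDual ℝ B),
      signExpectation n (fun ε => φ (walshPaley x₀ x n ε)) =
        SignTree.expect (· + ·) φ (ofIncrements n x) x₀
  | 0, x, x₀ => signExpectation_walshPaley_zero φ x₀ x
  | n + 1, x, x₀ => by
    rw [signExpectation_walshPaley_succ, signExpectation_walshPaley φ n,
      signExpectation_walshPaley φ n]
    rfl

theorem signExpectation_walshPaley_toIncrements_leaf (φ : StrongDual ℝ B → ℝ≥0∞) :
    ∀ (n : ℕ) (x₀ : StrongDual ℝ B),
      signExpectation n (fun ε => φ (walshPaley x₀ (toIncrements .leaf) n ε)) = φ x₀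
  | 0, x₀ => signExpectation_walshPaley_zero φ x₀ _
  | n + 1, x₀ => by
    have h : ∀ e, shift (toIncrements (B := B) .leaf) e = toIncrements .leaf := fun _ => rfl
    rw [signExpectation_walshPaley_succ, h, h]
    have h₀ : toIncrements (B := B) .leaf 0 Fin.elim0 = 0 := rfl
    rw [h₀, neg_zero, add_zero]
    rw [signExpectation_walshPaley_toIncrements_leaf φ n, ENNReal.add_div, ENNReal.add_halves]

theorem signExpectation_walshPaley_toIncrements (φ : StrongDual ℝ B → ℝ≥0∞) :
    ∀ (t : SignTree (StrongDual ℝ B)) (n : ℕ) (x₀ : StrongDual ℝ B), t.depth ≤ n →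
      signExpectation n (fun ε => φ (walshPaley x₀ (toIncrements t) n ε)) =
        SignTree.expect (· + ·) φ t x₀
  | .leaf, n, x₀, _ => signExpectation_walshPaley_toIncrements_leaf φ n x₀
  | .node x l r, 0, x₀, h => by simp [SignTree.depth] at h
  | .node x l r, n + 1, x₀, h => by
    rw [SignTree.depth, Nat.add_le_add_iff_right] at h
    rw [signExpectation_walshPaley_succ, shift_toIncrements_one, shift_toIncrements_neg_one,
      signExpectation_walshPaley_toIncrements φ l n _ ((le_max_left _ _).trans h),
      signExpectation_walshPaley_toIncrements φ r n _ ((le_max_right _ _).trans h)]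
    rfl

theorem growthBound_of_signExpectation_le {N G : StrongDual ℝ B → ℝ≥0∞} {r D : ℝ} (hG : G 0 = 0)
    (h : ∀ (x : Increments B) (n : ℕ) (c : ℝ≥0∞), 1 ≤ n → (∀ i ε, G (x i ε) ≤ c) →
      signExpectation n (fun ε => N (walshPaley 0 x n ε)) ≤
        ENNReal.ofReal (D * ((n : ℝ) + 1) ^ (1 / r)) * c) :
    SignTree.GrowthBound N G r D := by
  intro n t c hn ht hc
  rw [← signExpectation_walshPaley_toIncrements N t n 0 ht]
  exact h _ n c hn (apply_toIncrements_of_all (P := fun x => G x ≤ c) (by simp [hG]) hc)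

/-! ### The dual norm and the gauge -/

theorem evenSubadditive_dualNorm (W : Set B) : EvenSubadditive (dualNorm W) where
  zero := by simp [dualNorm]
  add_le x y := by
    refine iSup₂_le fun w hw => ?_
    exact (enorm_add_le (x w) (y w)).trans
      (add_le_add (le_iSup₂_of_le w hw le_rfl) (le_iSup₂_of_le w hw le_rfl))
  neg x := by simp [dualNorm]

theorem egauge_neg_of_neg_mem {E : Type*} [AddCommGroup E] [Module ℝ E] {X : Set E}
    (hX : ∀ x ∈ X, -x ∈ X) (x : E) : egauge ℝ X (-x) = egauge ℝ X x := by
  have h : ∀ x, egauge ℝ X (-x) ≤ egauge ℝ X x := fun x => by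
    refine le_egauge_iff.2 fun c hc => egauge_le_of_mem_smul ?_
    obtain ⟨z, hz, rfl⟩ := hc
    exact ⟨-z, hX z hz, smul_neg c z⟩
  exact le_antisymm (h x) (by simpa using h (-x))

theorem balanced_of_convex_of_neg_mem {E : Type*} [AddCommGroup E] [Module ℝ E] {X : Set E}
    (hconv : Convex ℝ X) (hX : ∀ x ∈ X, -x ∈ X) : Balanced ℝ X := by
  rintro c hc _ ⟨z, hz, rfl⟩
  rw [Real.norm_eq_abs, abs_le] at hc
  have h := hconv hz (hX z hz) (a := (1 + c) / 2) (b := (1 - c) / 2) (by linarith) (by linarith)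
    (by ring)
  have : ((1 + c) / 2) • z + ((1 - c) / 2) • -z = c • z := by module
  rwa [this] at h

/-! ### The growth of martingales -/

theorem growthBound_of_martingaleGrowth {W : Set B} {X : Set (StrongDual ℝ B)} {r D : ℝ}
    (hX : X.Nonempty) (h : MartingaleGrowth W X r D) :
    SignTree.GrowthBound (dualNorm W) (egauge ℝ X) r D := by
  refine growthBound_of_signExpectation_le (egauge_zero_right ℝ hX) fun x n c hn hc => ?_
  refine (h 0 x n hn).trans ?_
  gcongr
  refine sup_le ?_ (iSup₂_le fun i ε => hc _ _)
  rw [egauge_zero_right ℝ hX]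
  exact zero_le

/-- A random sign averages to zero against anything that does not depend on it. -/
theorem sum_signs_mul_eq_zero {n : ℕ} (t : Fin n) (h : (Fin n → ℤˣ) → ℝ)
    (hh : ∀ ε, h (Function.update ε t (-ε t)) = h ε) :
    ∑ ε : Fin n → ℤˣ, ((ε t : ℤ) : ℝ) * h ε = 0 := by
  refine Finset.sum_involution (fun ε _ => Function.update ε t (-ε t)) ?_ ?_ ?_ ?_
  · intro ε _
    rw [hh]
    simp
  · intro ε _ _ heq
    have := congrFun heq t
    rw [Function.update_self] at this
    exact units_ne_neg_self (ε t) this.symm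
  · simp
  · intro ε _
    simp

/-- An algorithm with small regret bounds the first moments of martingales: against the costs
`εₜ xₜ(ε)` it pays nothing in expectation. -/
theorem signExpectation_le_of_regret_le {W : Set B} {X : Set (StrongDual ℝ B)}
    (hW : ∀ w ∈ W, -w ∈ W) (hX : ∀ x ∈ X, -x ∈ X) {n : ℕ} (hn : 0 < n) {v c : ℝ} (hc : 0 < c)
    {A : Algorithm W (linearCosts W X)} (hA : ∀ f : Fin n → linearCosts W X, regret A n f ≤ v)
    {x : Increments B} (hx : ∀ i ε, c⁻¹ • x i ε ∈ X) :
    signExpectation n (fun ε => dualNorm W (walshPaley 0 x n ε)) ≤ ENNReal.ofReal (n * v * c) := by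
  -- The pieces of a path, and the costs that it stands for.
  let z : (Fin n → ℤˣ) → Fin n → StrongDual ℝ B :=
    fun ε t => x t (fun j : Fin t => ε (Fin.castLE t.isLt.le j))
  have hmem : ∀ ε t, c⁻¹ • ((ε t : ℤ) : ℝ) • z ε t ∈ X := by
    intro ε t
    rcases Int.units_eq_one_or (ε t) with h | h
    · simpa [h] using hx _ _
    · have h₁ : c⁻¹ • (((-1 : ℤˣ) : ℤ) : ℝ) • z ε t = -(c⁻¹ • z ε t) := by
        ext w
        simp
      rw [h, h₁]
      exact hX _ (hx _ _)
  let f : (Fin n → ℤˣ) → Fin n → linearCosts W X :=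
    fun ε t => ⟨fun w => (c⁻¹ • ((ε t : ℤ) : ℝ) • z ε t) w, _, hmem ε t, rfl⟩
  let α : (Fin n → ℤˣ) → Fin n → W := fun ε t => A t (fun j : Fin t => f ε (Fin.castLE t.isLt.le j))
  have hzupd : ∀ ε (t s : Fin n) e, s ≤ t → z (Function.update ε t e) s = z ε s := by
    intro ε t s e hst
    refine congrArg (x s) (funext fun j => ?_)
    refine Function.update_of_ne (fun h => ?_) _ _
    have h₁ : (j : ℕ) = t := congrArg Fin.val h
    have h₂ := j.isLt
    have h₃ : (s : ℕ) ≤ t := hst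
    omega
  have hαupd : ∀ ε (t : Fin n) e, α (Function.update ε t e) t = α ε t := by
    intro ε t e
    refine congrArg (A t) (funext fun j => Subtype.ext (funext fun w => ?_))
    have hlt : Fin.castLE t.isLt.le j < t := j.isLt
    simp only [f]
    rw [hzupd ε t _ e hlt.le, Function.update_of_ne hlt.ne]
  let R : (Fin n → ℤˣ) → ℝ := fun ε => ∑ t, ((ε t : ℤ) : ℝ) * z ε t (α ε t)
  have hR : ∑ ε, R ε = 0 := by
    rw [Finset.sum_comm]
    refine Finset.sum_eq_zero fun t _ => sum_signs_mul_eq_zero t (fun ε => z ε t (α ε t)) ?_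
    intro ε
    rw [hzupd ε t t _ le_rfl, hαupd]
  have hone : ∀ ε (w : W), R ε - walshPaley 0 x n ε w ≤ n * v * c := by
    intro ε w
    have h := sub_le_of_regret_le hn (hA (f ε)) w
    have h₁ : ∑ t : Fin n, (f ε t : W → ℝ) (A t (fun j : Fin t => f ε (Fin.castLE t.isLt.le j))) =
        c⁻¹ * R ε := by
      rw [Finset.mul_sum]
      exact Finset.sum_congr rfl fun t _ => by simp [f, α]
    have h₂ : ∑ t : Fin n, (f ε t : W → ℝ) w = c⁻¹ * walshPaley 0 x n ε w := by
      simp [f, z, walshPaley, Finset.mul_sum]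
    rw [h₁, h₂, ← mul_sub, inv_mul_le_iff₀ hc] at h
    linarith
  have habs : ∀ ε (w : W), |walshPaley 0 x n ε w| ≤ n * v * c - R ε := by
    intro ε w
    have h₁ := hone ε w
    have h₂ := hone ε ⟨-w, hW w w.2⟩
    simp only [map_neg] at h₂
    rw [abs_le]
    constructor <;> linarith
  have hnorm : ∀ ε, dualNorm W (walshPaley 0 x n ε) ≤ ENNReal.ofReal (n * v * c - R ε) := by
    refine fun ε => iSup₂_le fun w hw => ?_
    rw [Real.enorm_eq_ofReal_abs]
    exact ENNReal.ofReal_le_ofReal (habs ε ⟨w, hw⟩)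
  refine (signExpectation_mono hnorm).trans_eq ?_
  unfold signExpectation
  rw [← ENNReal.ofReal_sum_of_nonneg fun ε _ => (abs_nonneg _).trans (habs ε (α ε ⟨0, hn⟩)),
    Finset.sum_sub_distrib, hR, sub_zero, Finset.sum_const, Finset.card_univ, Fintype.card_fun,
    Fintype.card_fin, Fintype.card_units_int, nsmul_eq_mul, Nat.cast_pow,
    ENNReal.ofReal_mul (by positivity), ENNReal.ofReal_pow (by norm_num), ← mul_assoc]
  norm_num
  rw [ENNReal.inv_mul_cancel (by simp) (by simp), one_mul]

theorem growthBound_of_linearValue_le {W : Set B} {X : Set (StrongDual ℝ B)}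
    (hW : ∀ w ∈ W, -w ∈ W) (hXconv : Convex ℝ X) (hX : ∀ x ∈ X, -x ∈ X) (hX0 : X.Nonempty)
    {r D : ℝ} (hr : 1 < r) (hD : 0 < D)
    (h : ∀ n : ℕ, 1 ≤ n →
      linearValue W X n ≤ ((D * (n : ℝ) ^ (-(1 - 1 / r)) : ℝ) : EReal)) :
    SignTree.GrowthBound (dualNorm W) (egauge ℝ X) r D := by
  refine growthBound_of_signExpectation_le (egauge_zero_right ℝ hX0) fun x n c hn hc => ?_
  have hn0 : (0 : ℝ) < n := by exact_mod_cast hn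
  have hK : 0 < D * ((n : ℝ) + 1) ^ (1 / r) := by positivity
  -- The passage from `n` to `n + 1` leaves room for an algorithm that is only nearly optimal.
  have hlt : D * (n : ℝ) ^ (-(1 - 1 / r)) < D * ((n : ℝ) + 1) ^ (1 / r) / n := by
    rw [lt_div_iff₀ hn0, mul_assoc]
    refine mul_lt_mul_of_pos_left ?_ hD
    have h₁ : (n : ℝ) ^ (-(1 - 1 / r)) * n = (n : ℝ) ^ (1 / r) := by
      nth_rewrite 2 [← Real.rpow_one (n : ℝ)]
      rw [← Real.rpow_add hn0]
      congr 1
      ring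
    rw [h₁]
    exact Real.rpow_lt_rpow hn0.le (by linarith) (by positivity)
  obtain ⟨A, hA⟩ := iInf_lt_iff.1 ((h n hn).trans_lt (EReal.coe_lt_coe_iff.2 hlt))
  have hA' : ∀ f : Fin n → linearCosts W X,
      regret A n f ≤ ((D * ((n : ℝ) + 1) ^ (1 / r) / n : ℝ) : EReal) :=
    fun f => (le_iSup _ f).trans hA.le
  rw [mul_comm, ← ENNReal.div_le_iff_le_mul (.inl (by simpa using hK)) (.inl (by simp))]
  refine le_of_forall_gt_imp_ge_of_dense fun c' hc' => ?_
  rw [ENNReal.div_le_iff_le_mul (.inl (by simpa using hK)) (.inl (by simp))]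
  rcases eq_or_ne c' ∞ with rfl | hc'top
  · rw [ENNReal.top_mul (by simpa using hK)]
    exact le_top
  have hc'0 : 0 < c'.toReal := ENNReal.toReal_pos (zero_le.trans_lt hc').ne' hc'top
  have hmem : ∀ i ε, c'.toReal⁻¹ • x i ε ∈ X := by
    intro i ε
    rw [← Set.mem_smul_set_iff_inv_smul_mem₀ hc'0.ne']
    refine mem_smul_of_egauge_lt (balanced_of_convex_of_neg_mem hXconv hX) ?_
    rw [Real.enorm_eq_ofReal hc'0.le, ENNReal.ofReal_toReal hc'top]
    exact (hc i ε).trans_lt hc'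
  refine (signExpectation_le_of_regret_le hW hX hn hc'0 hA' hmem).trans_eq ?_
  rw [mul_div_cancel₀ _ hn0.ne', ENNReal.ofReal_mul hK.le, ENNReal.ofReal_toReal hc'top, mul_comm]

/-! ### Martingale type -/

theorem MartingaleTypeWith.mono {W : Set B} {X : Set (StrongDual ℝ B)} {p C C' : ℝ} (hp : 0 < p)
    (hC : C ≤ C') (h : MartingaleTypeWith W X p C) : MartingaleTypeWith W X p C' :=
  fun x₀ x => (h x₀ x).trans <| by gcongr

theorem MartingaleTypeWith.hasMartingaleType {W : Set B} {X : Set (StrongDual ℝ B)} {p C : ℝ}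
    (hp : 0 < p) (h : MartingaleTypeWith W X p C) : HasMartingaleType W X p :=
  ⟨max 1 C, le_max_left _ _, h.mono hp (le_max_right _ _)⟩

theorem martingaleTypeWith_of_not_nonempty {W : Set B} {X : Set (StrongDual ℝ B)} {p C : ℝ}
    (hp : 0 < p) (hC : 0 < C) (hX : ¬ X.Nonempty) : MartingaleTypeWith W X p C := by
  intro x₀ x
  rw [Set.not_nonempty_iff_eq_empty.1 hX, egauge_empty, ENNReal.top_rpow_of_pos hp, top_add,
    ENNReal.mul_top]
  · exact le_top
  · exact (ENNReal.rpow_pos (by simpa using hC) ENNReal.ofReal_ne_top).ne'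

theorem martingaleTypeWith_of_growthBound {W : Set B} {X : Set (StrongDual ℝ B)}
    (hX : ∀ x ∈ X, -x ∈ X) (hX0 : X.Nonempty) {r D p : ℝ} (hr : 1 < r) (hr2 : r ≤ 2) (hD : 0 < D)
    (hp : 0 < p) (hpr : p < r) (h : SignTree.GrowthBound (dualNorm W) (egauge ℝ X) r D) :
    MartingaleTypeWith W X p (1104 * D / (r - p) ^ 2) := by
  have hrp : 0 < r - p := by linarith
  have hN := evenSubadditive_dualNorm W
  intro x₀ x
  refine iSup_le fun n => ?_
  rw [signExpectation_walshPaley (fun v => dualNorm W v ^ p)]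
  have key : SignTree.expect (· + ·) (fun v => dualNorm W v ^ p) (ofIncrements n x) x₀ ≤
      ENNReal.ofReal (1104 * D / (r - p) ^ 2) ^ p *
        SignTree.expect (SignTree.track (dualNorm W) (egauge ℝ X) p) (fun a => a.2.2)
          (ofIncrements n x) (x₀, dualNorm W x₀, egauge ℝ X x₀ ^ p) := by
    rcases le_total p 1 with hp1 | hp1
    · refine (SignTree.expect_rpow_le_of_le_one h hN hr hD hp hp1 _ x₀).trans ?_
      gcongr ENNReal.ofReal ?_ ^ p * _
      rw [le_div_iff₀ (by positivity)]
      have : (r - p) ^ 2 ≤ 4 := by nlinarith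
      nlinarith
    · refine (SignTree.expect_rpow_le_of_one_le h hN (egauge_zero_right ℝ hX0)
        (egauge_neg_of_neg_mem hX) hr hr2 hD hp1 hpr _ x₀).trans ?_
      gcongr ENNReal.ofReal ?_ ^ p * _
      rw [div_le_div_iff₀ hrp (by positivity)]
      have h₁ : r - p ≤ 1 := by linarith
      have h₂ : 0 ≤ D * (r - p) * (1 - (r - p)) := by
        have : 0 ≤ 1 - (r - p) := by linarith
        positivity
      have h₃ : 0 < D * (r - p) := by positivity
      nlinarith
  refine key.trans ?_
  rw [expect_track_ofIncrements (egauge_neg_of_neg_mem hX)]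
  gcongr
  exact ENNReal.sum_le_tsum _

end OnlineGame

end

theorem mainTheorem3 {B : Type*} [AddCommGroup B] [Module ℝ B] [TopologicalSpace B]
    [IsTopologicalAddGroup B] [ContinuousSMul ℝ B]
    (W : Set B) (X : Set (StrongDual ℝ B))
    (hWconv : Convex ℝ W) (hWsymm : ∀ w ∈ W, -w ∈ W)
    (hXconv : Convex ℝ X) (hXsymm : ∀ x ∈ X, -x ∈ X)
    (r D : ℝ) (hr1 : 1 < r) (hr2 : r ≤ 2) (hD : 0 < D) :
    ((∀ n : ℕ, 1 ≤ n →
        OnlineGame.linearValue W X n ≤ ((D * (n : ℝ) ^ (-(1 - 1 / r)) : ℝ) : EReal)) →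
      ∀ p : ℝ, 0 < p → p < r →
        OnlineGame.MartingaleTypeWith W X p (1104 * D / (r - p) ^ 2) ∧
          OnlineGame.HasMartingaleType W X p) ∧
    (OnlineGame.MartingaleGrowth W X r D →
      ∀ p : ℝ, 0 < p → p < r →
        OnlineGame.MartingaleTypeWith W X p (1104 * D / (r - p) ^ 2) ∧
          OnlineGame.HasMartingaleType W X p) := by
  have hmain : ∀ p : ℝ, 0 < p → p < r →
      (X.Nonempty → SignTree.GrowthBound (OnlineGame.dualNorm W) (egauge ℝ X) r D) →
      OnlineGame.MartingaleTypeWith W X p (1104 * D / (r - p) ^ 2) ∧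
        OnlineGame.HasMartingaleType W X p := by
    intro p hp hpr hgrowth
    have h : OnlineGame.MartingaleTypeWith W X p (1104 * D / (r - p) ^ 2) := by
      by_cases hX0 : X.Nonempty
      · exact OnlineGame.martingaleTypeWith_of_growthBound hXsymm hX0 hr1 hr2 hD hp hpr
          (hgrowth hX0)
      · have : 0 < r - p := by linarith
        exact OnlineGame.martingaleTypeWith_of_not_nonempty hp (by positivity) hX0
    exact ⟨h, h.hasMartingaleType hp⟩
  exact ⟨fun h p hp hpr => hmain p hp hpr fun hX0 =>
      OnlineGame.growthBound_of_linearValue_le hWsymm hXconv hXsymm hX0 hr1 hD h,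
    fun h p hp hpr => hmain p hp hpr fun hX0 => OnlineGame.growthBound_of_martingaleGrowth hX0 h⟩
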